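/- Let $\Omega\subset\mathbb R^N$ be a bounded, connected, nonempty open set with Lipschitz boundary. For $x,y\in\overline\Omega$ let $d(x,y)$ be the geodesic distance, i.e. the infimum of the lengths of the curves in $\overline\Omega$ joining $x$ to $y$ (so $d(x,y)=|x-y|$ if $\Omega$ is convex). Let $\mathrm{Lip}(\overline\Omega)$ be the space of functions $u:\overline\Omega\to\mathbb R$ that are Lipschitz with respect to $d$, and $\mathrm{Lip}_1(\overline\Omega)=\{u:\ |u(x)-u(y)|\le d(x,y)\ \forall x,y\in\overline\Omega\}$. For a linear functional $Q$ on $\mathrm{Lip}(\overline\Omega)$ put $\|Q\|_1=\sup\{\langle Q,u\rangle: u\in\mathrm{Lip}_1(\overline\Omega)\}$, and let $\mathcal M_{0,1}(\overline\Omega)$ be the closure with respect to $\|\cdot\|_1$, among these functionals, of the set of signed Borel measures $\nu$ on $\overline\Omega$ with $\nu(\overline\Omega)=0$, acting by $u\mapsto\int u\,d\nu$; equivalently, the completion of this space of measures in the dual of $\mathrm{Lip}(\overline\Omega)/\mathbb R$. Let $\mathcal D(\mathbb R^N)$ be the space of smooth compactly supported real functions on $\mathbb R^N$; these act through their restrictions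 to $\overline\Omega$. Let $Q\in\mathcal M_{0,1}(\overline\Omega)$ and $\Lambda_0>0$. For a measure $C$ on $\overline\Omega$ with values in the symmetric nonnegative definite $N\times N$ matrices define $$J(C)=\sup_{u\in\mathcal D(\mathbb R^N)}\bigl(2\langle Q,u\rangle-\langle C,\nabla u\otimes\nabla u\rangle\bigr)\in[0,\infty],\qquad \langle C,\nabla u\otimes\nabla u\rangle=\sum_{i,j=1}^N\int_{\overline\Omega}\partial_iu\,\partial_ju\,dC_{ij},$$ and let $$Y=\inf\{J(C):\ \operatorname{tr}C(\overline\Omega)\le\Lambda_0\}.$$ Then $0\le Y<\infty$ and $$\sqrt Y=\frac1{\sqrt{\Lambda_0}}\ \sup_{u\in\mathcal D(\mathbb R^N)\cap\mathrm{Lip}_1(\overline\Omega)}\langle Q,u\rangle=\frac1{\sqrt{\Lambda_0}}\,\|Q\|_1 .$$ Moreover there exists $\hat u\in\mathrm{Lip}_1(\overline\Omega)$ with $\langle Q,\hat u\rangle=\|Q\|_1$. -/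

import Mathlib

open MeasureTheory Set Filter Topology
open scoped NNReal ENNReal Distributions Gradient

noncomputable section

namespace ThermalCompliance

variable {N : ℕ}

/-- `Ω` has a Lipschitz continuous boundary: near each boundary point, in suitable orthogonal
coordinates (a unit direction `e` and its orthogonal complement), `Ω` is the set of points lying
strictly below the graph of a Lipschitz function. -/
def HasLipschitzBoundary (Ω : Set (EuclideanSpace ℝ (Fin N))) : Prop :=
  ∀ x ∈ frontier Ω, ∃ e : EuclideanSpace ℝ (Fin N), ‖e‖ = 1 ∧
    ∃ (g : (Submodule.span ℝ {e})ᗮ → ℝ) (L : ℝ≥0), LipschitzWith L g ∧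
      ∀ᶠ y in 𝓝 x,
        (y ∈ Ω ↔ inner ℝ e y < g ((Submodule.span ℝ {e})ᗮ.orthogonalProjectionOnto y))

/-- The geodesic distance of `K`: the infimum of the lengths of curves joining `x` to `y` in `K`. -/
def geodesicEDist (K : Set (EuclideanSpace ℝ (Fin N))) (x y : EuclideanSpace ℝ (Fin N)) : ℝ≥0∞ :=
  ⨅ (γ : Path x y) (_ : ∀ t, γ t ∈ K), eVariationOn γ univ

theorem edist_le_geodesicEDist (K : Set (EuclideanSpace ℝ (Fin N)))
    (x y : EuclideanSpace ℝ (Fin N)) : edist x y ≤ geodesicEDist K x y := by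
  refine le_iInf₂ fun γ _ => ?_
  have h := eVariationOn.edist_le γ (mem_univ (0 : unitInterval)) (mem_univ 1)
  simpa using h

/-- On a convex set the geodesic distance is the Euclidean distance. -/
theorem geodesicEDist_eq_edist {K : Set (EuclideanSpace ℝ (Fin N))} (hK : Convex ℝ K)
    {x y : EuclideanSpace ℝ (Fin N)} (hx : x ∈ K) (hy : y ∈ K) :
    geodesicEDist K x y = edist x y := by
  refine le_antisymm ?_ (edist_le_geodesicEDist K x y)
  let γ : Path x y :=
    { toFun := fun t => AffineMap.lineMap x y (t : ℝ)
      continuous_toFun := by fun_prop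
      source' := by simp
      target' := by simp }
  have hγ : ∀ t, γ t ∈ K := fun t => hK.lineMap_mem hx hy t.2
  refine (iInf₂_le γ hγ).trans ?_
  have h1 : eVariationOn (fun t : unitInterval => (t : ℝ)) univ ≤ 1 := by
    have h := MonotoneOn.eVariationOn_le (f := fun t : unitInterval => (t : ℝ)) (s := univ)
      (fun _ _ _ _ h => h) (mem_univ 0) (mem_univ 1)
    have hI : (univ : Set unitInterval) ∩ Icc 0 1 = univ :=
      eq_univ_of_forall fun t => ⟨mem_univ t, unitInterval.nonneg', unitInterval.le_one'⟩
    rw [hI] at h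
    simpa using h
  have h2 := (lipschitzWith_lineMap (𝕜 := ℝ) x y).lipschitzOnWith.comp_eVariationOn_le
    (s := univ) (mapsTo_univ (fun t : unitInterval => (t : ℝ)) univ)
  refine h2.trans ((mul_le_mul_right h1 _).trans ?_)
  rw [mul_one, edist_nndist]

/-- `Lip(Ω̄)`: the real functions on the closure of `Ω` that are Lipschitz for the geodesic
distance of the closure. -/
def LipFun (Ω : Set (EuclideanSpace ℝ (Fin N))) : Submodule ℝ (closure Ω → ℝ) where
  carrier := {u | ∃ L : ℝ≥0, ∀ x y : closure Ω,
    edist (u x) (u y) ≤ L * geodesicEDist (closure Ω) x y}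
  zero_mem' := ⟨0, by simp⟩
  add_mem' := by
    rintro u v ⟨L, hL⟩ ⟨M, hM⟩
    refine ⟨L + M, fun x y => ?_⟩
    rw [ENNReal.coe_add, add_mul]
    exact (edist_add_add_le _ _ _ _).trans (add_le_add (hL x y) (hM x y))
  smul_mem' := by
    rintro c u ⟨L, hL⟩
    refine ⟨‖c‖₊ * L, fun x y => ?_⟩
    rw [Pi.smul_apply, Pi.smul_apply, edist_smul₀, ENNReal.coe_mul, mul_assoc,
      ENNReal.smul_def, smul_eq_mul]
    exact mul_le_mul_right (hL x y) _

/-- `Lip₁(Ω̄)`: the functions on the closure of `Ω` that are 1-Lipschitz for the geodesic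
distance. -/
def LipOne (Ω : Set (EuclideanSpace ℝ (Fin N))) : Set (LipFun Ω) :=
  {u | ∀ x y : closure Ω, edist (u.1 x) (u.1 y) ≤ geodesicEDist (closure Ω) x y}

/-- The restriction to the closure of `Ω` of a test function on `ℝ^N`. -/
def restrictTest (Ω : Set (EuclideanSpace ℝ (Fin N)))
    (φ : 𝓓((⊤ : TopologicalSpace.Opens (EuclideanSpace ℝ (Fin N))), ℝ)) : LipFun Ω :=
  ⟨fun x => φ x, by
    obtain ⟨L, hL⟩ := ContDiff.lipschitzWith_of_hasCompactSupport (𝕂 := ℝ)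
      φ.hasCompactSupport φ.contDiff (by simp)
    exact ⟨L, fun x y => (hL x y).trans
      (mul_le_mul_right (edist_le_geodesicEDist _ _ _) _)⟩⟩

/-- The Kantorovich norm `‖F‖₁ = sup {F u : u ∈ Lip₁(Ω̄)}`, as an extended real number. -/
def kantorovichNorm {Ω : Set (EuclideanSpace ℝ (Fin N))} (F : LipFun Ω → ℝ) : EReal :=
  ⨆ u ∈ LipOne Ω, (F u : EReal)

/-- The action of a signed measure on a function, `∫ u dν`. -/
def pairing {X : Type*} [MeasurableSpace X] (ν : SignedMeasure X) (u : X → ℝ) : ℝ :=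
  ν.integral u (ContinuousLinearMap.lsmul ℝ ℝ)

/-- `M_{0,1}(Ω̄)`: the closure, for the Kantorovich norm, of the space of signed measures on the
closure of `Ω` of total mass zero, inside the linear functionals on `Lip(Ω̄)`. (Such limits vanish
on constants and are bounded for the Lipschitz seminorm, hence they are elements of the dual of
`Lip(Ω̄)/ℝ`, where this closure is the completion.) -/
def MZeroOne (Ω : Set (EuclideanSpace ℝ (Fin N))) : Set (LipFun Ω →ₗ[ℝ] ℝ) :=
  {Q | ∀ ε : ℝ, 0 < ε → ∃ ν : SignedMeasure (closure Ω), ν univ = 0 ∧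
    kantorovichNorm (fun u : LipFun Ω => Q u - pairing ν u.1) ≤ ε}

/-- Matrix-valued Borel measures on the closure of `Ω`. -/
abbrev TensorMeasure (Ω : Set (EuclideanSpace ℝ (Fin N))) :=
  VectorMeasure (closure Ω) (Matrix (Fin N) (Fin N) ℝ)

/-- The entries of a matrix-valued measure. -/
def TensorMeasure.entry {Ω : Set (EuclideanSpace ℝ (Fin N))} (C : TensorMeasure Ω)
    (i j : Fin N) : SignedMeasure (closure Ω) :=
  C.mapRange (Matrix.entryAddMonoidHom ℝ i j) (continuous_id.matrix_elem i j)

/-- `M_{Λ₀}(Ω̄)`: the measures with values in the symmetric nonnegative definite matrices whose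
trace has total mass at most `Λ₀`. -/
def admissibleTensors (Ω : Set (EuclideanSpace ℝ (Fin N))) (Λ₀ : ℝ) : Set (TensorMeasure Ω) :=
  {C | (∀ s, MeasurableSet s → (C s).PosSemidef) ∧ (C univ).trace ≤ Λ₀}

/-- `⟨C, ∇φ ⊗ ∇φ⟩`. -/
def tensorEnergy {Ω : Set (EuclideanSpace ℝ (Fin N))} (C : TensorMeasure Ω)
    (φ : 𝓓((⊤ : TopologicalSpace.Opens (EuclideanSpace ℝ (Fin N))), ℝ)) : ℝ :=
  ∑ i, ∑ j, pairing (C.entry i j) fun x => (∇ φ (x : EuclideanSpace ℝ (Fin N))) i * (∇ φ x) j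

/-- The energy `E(C, φ) = ½⟨C, ∇φ ⊗ ∇φ⟩ - ⟨Q, φ⟩`. -/
def energy {Ω : Set (EuclideanSpace ℝ (Fin N))} (Q : LipFun Ω →ₗ[ℝ] ℝ) (C : TensorMeasure Ω)
    (φ : 𝓓((⊤ : TopologicalSpace.Opens (EuclideanSpace ℝ (Fin N))), ℝ)) : ℝ :=
  1 / 2 * tensorEnergy C φ - Q (restrictTest Ω φ)

/-- The relaxed thermal compliance `J(C) = sup_φ (-2 E(C, φ))`; it may be `+∞`. -/
def compliance {Ω : Set (EuclideanSpace ℝ (Fin N))} (Q : LipFun Ω →ₗ[ℝ] ℝ)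
    (C : TensorMeasure Ω) : EReal :=
  ⨆ φ, ((-2 * energy Q C φ : ℝ) : EReal)

/-- The optimal value `Y = inf {J(C) : tr C(Ω̄) ≤ Λ₀}`. -/
def optimalCompliance {Ω : Set (EuclideanSpace ℝ (Fin N))} (Q : LipFun Ω →ₗ[ℝ] ℝ)
    (Λ₀ : ℝ) : EReal :=
  ⨅ C ∈ admissibleTensors Ω Λ₀, compliance Q C

end ThermalCompliance

end

open scoped ContDiff

namespace ThermalCompliance

variable {N : ℕ}

/-! Write `R = ‖Q‖₁`. The identity `Y = R² / Λ₀` comes from two bounds.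

Lower bound. A test function `φ` in `Lip₁` has `|∇φ| ≤ 1` on the closure, so `⟨C, ∇φ ⊗ ∇φ⟩ ≤ tr
C(Ω̄) ≤ Λ₀` for every admissible `C` (`tensorEnergy_le`). Testing `J(C)` with `tφ` gives `J(C) ≥
2t⟨Q, φ⟩ - t²Λ₀`. With `t = R / Λ₀` and `⟨Q, φ⟩` close to `R` this tends to `R² / Λ₀`.

Upper bound. By scaling, `⟨Q, φ⟩ ≤ R sup |∇φ|`. Hahn–Banach and Riesz–Markov give a measure `μ` of
mass at most `R` with `⟨Q, φ⟩ ≤ ∫ |∇φ| dμ`; Riesz in `L²(μ)` then gives `⟨Q, φ⟩ = ∫ θ · ∇φ dμ` with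
`∫ |θ|² dμ ≤ R` (`exists_density`). For `R > 0` the tensor `C = (Λ₀ / R) θ ⊗ θ μ` is admissible, and
Cauchy–Schwarz gives `J(C) ≤ R² / Λ₀`.

Both bounds need gradient bounds to match `Lip₁`. A `C¹` function with `|∇φ| ≤ 1` on the closure is
1-Lipschitz for `d`, by subdividing curves. Conversely, every element of `Lip₁` is a uniform limit
of test functions in `Lip₁`: compose with a smooth near-identity map sending the closure into `Ω`
(`exists_push`), mollify and rescale. All that is used of `d` here is that it is at most Euclidean
along segments of the closure. Finally, `Q` is a uniform limit on `Lip₁` of integrals against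
measures, hence continuous there for uniform convergence; Arzelà–Ascoli yields `û`. -/

/-! ### Pushing the closure of a Lipschitz domain into the domain -/

/-- Real functions that are 1-Lipschitz along the segments contained in `K`. -/
def IsSegmentLip (K : Set (EuclideanSpace ℝ (Fin N))) (v : EuclideanSpace ℝ (Fin N) → ℝ) : Prop :=
  ∀ x y, segment ℝ x y ⊆ K → dist (v x) (v y) ≤ dist x y

/-- Every point of the closure of a Lipschitz domain has a neighbourhood in which the domain can
be entered by translation along a fixed direction. -/
theorem exists_inward_direction {Ω : Set (EuclideanSpace ℝ (Fin N))} (hΩ : IsOpen Ω)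
    (hlip : HasLipschitzBoundary Ω) {x : EuclideanSpace ℝ (Fin N)} (hx : x ∈ closure Ω) :
    ∃ e : EuclideanSpace ℝ (Fin N), ‖e‖ ≤ 1 ∧ ∃ r > 0, ∀ y ∈ closure Ω, y ∈ Metric.ball x r →
      ∀ s ∈ Ioc 0 r, y - s • e ∈ Ω := by
  by_cases hxΩ : x ∈ Ω
  · obtain ⟨r, hr, hball⟩ := Metric.isOpen_iff.1 hΩ x hxΩ
    exact ⟨0, by simp, r, hr, fun y _ hy s _ => by simpa using hball hy⟩
  have hfr : x ∈ frontier Ω := by rw [hΩ.frontier_eq]; exact ⟨hx, hxΩ⟩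
  obtain ⟨e, he, g, L, hg, hev⟩ := hlip x hfr
  obtain ⟨r, hr, hball⟩ := Metric.eventually_nhds_iff_ball.1 hev
  set P := (Submodule.span ℝ {e})ᗮ.orthogonalProjectionOnto with hP
  have hPe : P e = 0 := by
    rw [hP, Submodule.orthogonalProjectionOnto_eq_zero_iff, Submodule.orthogonal_orthogonal]
    exact Submodule.mem_span_singleton_self e
  have hcl : ∀ y ∈ closure Ω, y ∈ Metric.ball x r → inner ℝ e y ≤ g (P y) := by
    intro y hy hyb
    have hcont : Continuous fun z => g (P z) := hg.continuous.comp P.continuous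
    have hin : Continuous fun z : EuclideanSpace ℝ (Fin N) => inner ℝ e z := by fun_prop
    have hmem : y ∈ closure (Metric.ball x r ∩ Ω) := Metric.isOpen_ball.inter_closure ⟨hyb, hy⟩
    refine closure_minimal (fun z hz => ?_) (isClosed_le hin hcont) hmem
    exact ((hball z hz.1).1 hz.2).le
  -- Half the radius, so that a point displaced by at most `r / 2` stays where the graph description
  -- is valid.
  refine ⟨e, he.le, r / 2, half_pos hr, fun y hy hyb s hs => ?_⟩
  have hyr : y ∈ Metric.ball x r := Metric.ball_subset_ball (by linarith) hyb
  have hmem : y - s • e ∈ Metric.ball x r := by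
    rw [Metric.mem_ball, dist_eq_norm] at hyb ⊢
    have h1 : ‖s • e‖ ≤ r / 2 := by
      rw [norm_smul, he, mul_one, Real.norm_of_nonneg hs.1.le]; exact hs.2
    calc ‖y - s • e - x‖ = ‖(y - x) - s • e‖ := by congr 1; abel
      _ ≤ ‖y - x‖ + ‖s • e‖ := norm_sub_le _ _
      _ < r := by linarith
  rw [hball _ hmem]
  -- Moving along `-e` keeps the graph height fixed and lowers the coordinate along `e` by `s`.
  have h2 : P (y - s • e) = P y := by rw [map_sub, map_smul, hPe, smul_zero, sub_zero]
  rw [h2, inner_sub_right, inner_smul_right, real_inner_self_eq_norm_sq, he]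
  have := hcl y hy hyr
  linarith [hs.1]

/-- A smooth map close to the identity, as an elementary push along one direction. -/
theorem exists_local_push {Ω : Set (EuclideanSpace ℝ (Fin N))}
    {c e : EuclideanSpace ℝ (Fin N)} (he : ‖e‖ ≤ 1) {r : ℝ} (hr : 0 < r)
    (hpush : ∀ y ∈ closure Ω, y ∈ Metric.ball c r → ∀ s ∈ Ioc 0 r, y - s • e ∈ Ω)
    {η : ℝ≥0} (hη : 0 < η) :
    ∃ T : EuclideanSpace ℝ (Fin N) → EuclideanSpace ℝ (Fin N), ContDiff ℝ ∞ T ∧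
      LipschitzWith (1 + η) T ∧ (∀ x, dist (T x) x ≤ η) ∧
      (∀ x ∈ closure Ω, T x = x ∨ T x ∈ Ω) ∧
      (∀ x ∈ closure Ω, x ∈ Metric.ball c r → T x ∈ Ω) ∧
      ∀ v, IsSegmentLip (closure Ω) v → ∀ x ∈ closure Ω, dist (v (T x)) (v x) ≤ η := by
  let b : ContDiffBump c := ⟨r / 2, r, half_pos hr, half_lt_self hr⟩
  obtain ⟨L, hL⟩ := ContDiff.lipschitzWith_of_hasCompactSupport (𝕂 := ℝ) (f := b)
    (n := ∞) b.hasCompactSupport b.contDiff (by simp)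
  -- The three bounds on `t` keep the push admissible, the displacement below `η`, and the Lipschitz
  -- excess `t * L` below `η`.
  obtain ⟨t, ht0, htr, htη, htL⟩ : ∃ t : ℝ, 0 < t ∧ t ≤ r ∧ t ≤ η ∧ t * L ≤ η := by
    have hη' : (0 : ℝ) < η := hη
    refine ⟨min r (min η (η / (L + 1))), by positivity, min_le_left _ _,
      (min_le_right _ _).trans (min_le_left _ _), ?_⟩
    have h1 : min r (min (η : ℝ) (η / (L + 1))) ≤ η / (L + 1) :=
      (min_le_right _ _).trans (min_le_right _ _)
    calc _ ≤ (η : ℝ) / (L + 1) * L := by gcongr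
      _ ≤ (η : ℝ) / (L + 1) * (L + 1) := by gcongr; linarith
      _ = η := by field_simp
  have hdist : ∀ x, ‖(t * b x) • e‖ ≤ t * b x := fun x => by
    rw [norm_smul, Real.norm_of_nonneg (mul_nonneg ht0.le b.nonneg)]
    exact mul_le_of_le_one_right (mul_nonneg ht0.le b.nonneg) he
  have hle : ∀ x, t * b x ≤ t := fun x => mul_le_of_le_one_right ht0.le b.le_one
  -- With every fraction `a` of the push allowed, the whole segment from `x` to its image lies in
  -- the closure, as the last property requires.
  have hin : ∀ x ∈ closure Ω, x ∈ Metric.ball c r → ∀ a ∈ Ioc (0 : ℝ) 1,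
      x - (a * (t * b x)) • e ∈ Ω := by
    intro x hx hxb a ha
    have hb : 0 < b x := b.pos_of_mem_ball hxb
    refine hpush x hx hxb _ ⟨by have := ha.1; positivity, ?_⟩
    calc a * (t * b x) ≤ 1 * t := by
          gcongr
          · exact ha.2
          · exact hle x
      _ ≤ r := by linarith
  have hout : ∀ x, x ∉ Metric.ball c r → b x = 0 := fun x hx =>
    b.zero_of_le_dist (by simpa using hx)
  have hball : ∀ x ∈ closure Ω, x ∈ Metric.ball c r → x - (t * b x) • e ∈ Ω := fun x hx hxb => by
    simpa using hin x hx hxb 1 (by simp)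
  refine ⟨fun x => x - (t * b x) • e, ?_, ?_, ?_, ?_, hball, ?_⟩
  · exact contDiff_id.sub ((contDiff_const.mul b.contDiff).smul contDiff_const)
  · refine LipschitzWith.of_dist_le_mul fun x y => ?_
    have h1 : dist (b x) (b y) ≤ L * dist x y := hL.dist_le_mul x y
    rw [dist_eq_norm]
    have h2 : x - (t * b x) • e - (y - (t * b y) • e) = (x - y) - (t * (b x - b y)) • e := by
      rw [mul_sub, sub_smul]; abel
    rw [h2]
    calc _ ≤ ‖x - y‖ + ‖(t * (b x - b y)) • e‖ := norm_sub_le _ _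
      _ ≤ dist x y + t * (L * dist x y) := by
        rw [← dist_eq_norm, norm_smul, norm_mul, Real.norm_of_nonneg ht0.le, ← dist_eq_norm]
        refine add_le_add_right ?_ _
        calc t * dist (b x) (b y) * ‖e‖ ≤ t * dist (b x) (b y) * 1 := by gcongr
          _ ≤ t * (L * dist x y) := by rw [mul_one]; gcongr
      _ = dist x y + (t * L) * dist x y := by ring
      _ ≤ dist x y + η * dist x y := by gcongr
      _ = _ := by push_cast; ring
  · intro x
    rw [dist_eq_norm, sub_sub_cancel_left, norm_neg]
    exact (hdist x).trans ((hle x).trans htη)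
  · intro x hx
    by_cases hxb : x ∈ Metric.ball c r
    · exact Or.inr (hball x hx hxb)
    · left; simp [hout x hxb]
  · intro v hv x hx
    by_cases hxb : x ∈ Metric.ball c r
    · refine (hv _ _ ?_).trans ?_
      · rw [segment_symm]
        rintro z hz
        rw [segment_eq_image'] at hz
        obtain ⟨a, ha, rfl⟩ := hz
        rcases ha.1.eq_or_lt with h0 | h0
        · simpa [← h0] using hx
        · have := hin x hx hxb a ⟨h0, ha.2⟩
          apply subset_closure
          convert this using 1
          simp only [sub_sub_cancel_left, smul_neg, smul_smul]
          abel
      · rw [dist_eq_norm, sub_sub_cancel_left, norm_neg]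
        exact (hdist x).trans ((hle x).trans htη)
    · simp [hout x hxb]

/-- For a bounded Lipschitz domain there are smooth maps, arbitrarily close to the identity in the
Lipschitz sense, that send the closure of the domain into the domain. -/
theorem exists_push {Ω : Set (EuclideanSpace ℝ (Fin N))} (hΩ : IsOpen Ω)
    (hbdd : Bornology.IsBounded Ω) (hlip : HasLipschitzBoundary Ω) {ε : ℝ≥0} (hε : 0 < ε) :
    ∃ T : EuclideanSpace ℝ (Fin N) → EuclideanSpace ℝ (Fin N), ContDiff ℝ ∞ T ∧
      LipschitzWith (1 + ε) T ∧ (∀ x, dist (T x) x ≤ ε) ∧ (∀ x ∈ closure Ω, T x ∈ Ω) ∧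
      ∀ v, IsSegmentLip (closure Ω) v → ∀ x ∈ closure Ω, dist (v (T x)) (v x) ≤ ε := by
  have hK : IsCompact (closure Ω) := hbdd.isCompact_closure
  choose! e he r hr hpush using fun x (hx : x ∈ closure Ω) => exists_inward_direction hΩ hlip hx
  obtain ⟨s, hsK, hscov⟩ := hK.elim_nhds_subcover (fun x => Metric.ball x (r x))
    fun x hx => Metric.ball_mem_nhds x (hr x hx)
  -- Local pushes are composed over a finite subcover. The alternative `T x = x ∨ T x ∈ Ω` ensures
  -- that a point already sent into `Ω` is kept there by the other maps.
  have key : ∀ s : Finset (EuclideanSpace ℝ (Fin N)), (∀ x ∈ s, x ∈ closure Ω) →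
      ∀ ε : ℝ≥0, 0 < ε → ∃ T : EuclideanSpace ℝ (Fin N) → EuclideanSpace ℝ (Fin N),
        ContDiff ℝ ∞ T ∧ LipschitzWith (1 + ε) T ∧ (∀ x, dist (T x) x ≤ ε) ∧
        (∀ x ∈ closure Ω, T x = x ∨ T x ∈ Ω) ∧
        (∀ x ∈ closure Ω, x ∈ ⋃ c ∈ s, Metric.ball c (r c) → T x ∈ Ω) ∧
        ∀ v, IsSegmentLip (closure Ω) v → ∀ x ∈ closure Ω, dist (v (T x)) (v x) ≤ ε := by
    intro s
    induction s using Finset.induction_on with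
    | empty =>
      intro _ ε _
      exact ⟨id, contDiff_id, LipschitzWith.id.weaken (by simp), by simp, by simp, by simp,
        by simp⟩
    | insert c s _ ih =>
      intro hs ε hε
      -- For `η ≤ 1`, `(1 + η)² ≤ 1 + 3η`.
      obtain ⟨η, hη, hη1, hη2⟩ : ∃ η : ℝ≥0, 0 < η ∧ η ≤ 1 ∧ 3 * η ≤ ε := by
        refine ⟨min 1 (ε / 3), by positivity, min_le_left _ _, ?_⟩
        calc 3 * min 1 (ε / 3) ≤ 3 * (ε / 3) := by gcongr; exact min_le_right _ _
          _ = ε := by field_simp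
      have hη2' : 3 * (η : ℝ) ≤ ε := by exact_mod_cast hη2
      have hη0 : (0 : ℝ) ≤ η := η.2
      obtain ⟨T, hT1, hT2, hT3, hT4, hT5, hT6⟩ := ih (fun x hx => hs x (by simp [hx])) η hη
      have hc : c ∈ closure Ω := hs c (by simp)
      obtain ⟨S, hS1, hS2, hS3, hS4, hS5, hS6⟩ :=
        exists_local_push (he c hc) (hr c hc) (hpush c hc) hη
      have hSK : ∀ x ∈ closure Ω, S x ∈ closure Ω := fun x hx => by
        rcases hS4 x hx with h | h
        · rwa [h]
        · exact subset_closure h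
      have hTΩ : ∀ x ∈ Ω, T x ∈ Ω := fun x hx => by
        rcases hT4 x (subset_closure hx) with h | h
        · rwa [h]
        · exact h
      refine ⟨T ∘ S, hT1.comp hS1, (hT2.comp hS2).weaken ?_, ?_, ?_, ?_, ?_⟩
      · calc (1 + η) * (1 + η) = 1 + (2 * η + η * η) := by ring
          _ ≤ 1 + (2 * η + 1 * η) := by gcongr
          _ = 1 + 3 * η := by ring
          _ ≤ 1 + ε := by gcongr
      · intro x
        have := dist_triangle (T (S x)) (S x) x
        simp only [Function.comp_apply]
        linarith [hT3 (S x), hS3 x]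
      · intro x hx
        rcases hS4 x hx with h | h
        · simpa [h] using hT4 x hx
        · exact Or.inr (hTΩ _ h)
      · intro x hx hmem
        rcases hS4 x hx with h | h
        · rw [Finset.set_biUnion_insert] at hmem
          rcases hmem with hmem | hmem
          · exact hTΩ _ (hS5 x hx hmem)
          · simpa [h] using hT5 x hx hmem
        · exact hTΩ _ h
      · intro v hv x hx
        have := dist_triangle (v (T (S x))) (v (S x)) (v x)
        simp only [Function.comp_apply]
        linarith [hT6 v hv (S x) (hSK x hx), hS6 v hv x hx]
  obtain ⟨T, h1, h2, h3, -, h5, h6⟩ := key s hsK ε hε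
  exact ⟨T, h1, h2, h3, fun x hx => h5 x hx (hscov hx), h6⟩

/-- A compact subset of an open set has a uniform neighbourhood in it. -/
theorem exists_ball_subset_of_push {Ω : Set (EuclideanSpace ℝ (Fin N))} (hΩ : IsOpen Ω)
    (hbdd : Bornology.IsBounded Ω) {T : EuclideanSpace ℝ (Fin N) → EuclideanSpace ℝ (Fin N)}
    (hT : Continuous T) (hTΩ : ∀ x ∈ closure Ω, T x ∈ Ω) :
    ∃ δ > 0, ∀ x ∈ closure Ω, Metric.ball (T x) δ ⊆ Ω := by
  obtain ⟨δ, hδ, h⟩ := (hbdd.isCompact_closure.image hT).exists_thickening_subset_open hΩ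
    (image_subset_iff.2 hTΩ)
  exact ⟨δ, hδ, fun x hx => (Metric.ball_subset_thickening (mem_image_of_mem T hx) δ).trans h⟩

/-! ### Equicontinuity and bounded oscillation -/

theorem IsSegmentLip.dist_le_of_ball {K : Set (EuclideanSpace ℝ (Fin N))}
    {v : EuclideanSpace ℝ (Fin N) → ℝ} (hv : IsSegmentLip K v) {z : EuclideanSpace ℝ (Fin N)}
    {δ : ℝ} (hball : Metric.ball z δ ⊆ K) {x y : EuclideanSpace ℝ (Fin N)}
    (hx : x ∈ Metric.ball z δ) (hy : y ∈ Metric.ball z δ) : dist (v x) (v y) ≤ dist x y :=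
  hv x y (((convex_ball z δ).segment_subset hx hy).trans hball)

/-- Functions that are 1-Lipschitz along segments are uniformly equicontinuous on the closure of
a Lipschitz domain. -/
theorem exists_forall_dist_lt {Ω : Set (EuclideanSpace ℝ (Fin N))} (hΩ : IsOpen Ω)
    (hbdd : Bornology.IsBounded Ω) (hlip : HasLipschitzBoundary Ω) {ε : ℝ} (hε : 0 < ε) :
    ∃ δ > 0, ∀ v, IsSegmentLip (closure Ω) v → ∀ x ∈ closure Ω, ∀ y ∈ closure Ω,
      dist x y < δ → dist (v x) (v y) < ε := by
  obtain ⟨η, hη, hη1⟩ : ∃ η : ℝ≥0, 0 < η ∧ 3 * (η : ℝ) ≤ ε :=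
    ⟨(ε / 3).toNNReal, by simpa using hε, by rw [Real.coe_toNNReal _ (by positivity)]; linarith⟩
  have hη0 : (0 : ℝ) < η := hη
  obtain ⟨T, hT1, hT2, -, hT4, hT5⟩ := exists_push hΩ hbdd hlip hη
  obtain ⟨δ, hδ, hball⟩ := exists_ball_subset_of_push hΩ hbdd hT1.continuous hT4
  refine ⟨min δ η / (1 + η), by positivity, fun v hv x hx y hy hxy => ?_⟩
  have h1 : dist (T x) (T y) < min δ η := by
    refine (hT2.dist_le_mul x y).trans_lt ?_
    rw [lt_div_iff₀ (by positivity)] at hxy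
    push_cast
    linarith
  -- Although the segment from `x` to `y` may leave the closure, the pushed points share a ball
  -- inside `Ω`.
  have h2 : dist (v (T x)) (v (T y)) ≤ dist (T x) (T y) := by
    refine hv.dist_le_of_ball ((hball x hx).trans subset_closure) (Metric.mem_ball_self hδ) ?_
    rw [Metric.mem_ball, dist_comm]
    exact h1.trans_le (min_le_left _ _)
  have h3 := dist_triangle4 (v x) (v (T x)) (v (T y)) (v y)
  rw [dist_comm (v x) (v (T x))] at h3
  linarith [hT5 v hv x hx, hT5 v hv y hy, min_le_right δ (η : ℝ)]

/-- Functions that are 1-Lipschitz along segments have uniformly bounded oscillation on the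
closure of a bounded connected Lipschitz domain. -/
theorem exists_forall_dist_le {Ω : Set (EuclideanSpace ℝ (Fin N))} (hΩ : IsOpen Ω)
    (hbdd : Bornology.IsBounded Ω) (hconn : IsConnected Ω) (hlip : HasLipschitzBoundary Ω) :
    ∃ D : ℝ, ∀ v, IsSegmentLip (closure Ω) v → ∀ x ∈ closure Ω, ∀ y ∈ closure Ω,
      dist (v x) (v y) ≤ D := by
  obtain ⟨x₀, hx₀⟩ := hconn.nonempty
  set U : Set (EuclideanSpace ℝ (Fin N)) := {z | z ∈ Ω ∧ ∃ D : ℝ, ∀ v,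
    IsSegmentLip (closure Ω) v → dist (v z) (v x₀) ≤ D}
  have hnear : ∀ z ∈ Ω, ∃ δ > 0, Metric.ball z δ ⊆ Ω ∧ ∀ z' ∈ Metric.ball z δ, ∀ v,
      IsSegmentLip (closure Ω) v → dist (v z) (v z') ≤ δ := by
    intro z hz
    obtain ⟨δ, hδ, hball⟩ := Metric.isOpen_iff.1 hΩ z hz
    refine ⟨δ, hδ, hball, fun z' hz' v hv => ?_⟩
    refine (hv.dist_le_of_ball (hball.trans subset_closure) (Metric.mem_ball_self hδ) hz').trans ?_
    rw [dist_comm]; exact hz'.le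
  -- The points whose oscillation from `x₀` is bounded uniformly in `v` form an open, relatively
  -- closed subset of the connected set `Ω`.
  have hUΩ : Ω ⊆ U := by
    refine hconn.isPreconnected.subset_of_closure_inter_subset ?_ ⟨x₀, hx₀, hx₀, 0, by simp⟩ ?_
    · refine Metric.isOpen_iff.2 fun z hz => ?_
      obtain ⟨hzΩ, D, hD⟩ := hz
      obtain ⟨δ, hδ, hball, hd⟩ := hnear z hzΩ
      refine ⟨δ, hδ, fun z' hz' => ⟨hball hz', δ + D, fun v hv => ?_⟩⟩
      have := dist_triangle (v z') (v z) (v x₀)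
      rw [dist_comm (v z') (v z)] at this
      linarith [hd z' hz' v hv, hD v hv]
    · rintro z ⟨hzU, hzΩ⟩
      obtain ⟨δ, hδ, hball, hd⟩ := hnear z hzΩ
      obtain ⟨z', ⟨-, D, hD⟩, hz'⟩ := Metric.mem_closure_iff.1 hzU δ hδ
      refine ⟨hzΩ, δ + D, fun v hv => ?_⟩
      have := dist_triangle (v z) (v z') (v x₀)
      linarith [hd z' (by rwa [Metric.mem_ball, dist_comm]) v hv, hD v hv]
  obtain ⟨δ, hδ, heq⟩ := exists_forall_dist_lt hΩ hbdd hlip one_pos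
  obtain ⟨s, hs, hcov⟩ := hbdd.isCompact_closure.elim_nhds_subcover (fun x => Metric.ball x (δ / 2))
    fun x _ => Metric.ball_mem_nhds x (half_pos hδ)
  have hfin : ∀ c ∈ s, ∃ D : ℝ, ∀ v, IsSegmentLip (closure Ω) v → dist (v c) (v x₀) ≤ D := by
    intro c hc
    obtain ⟨z, hz, hcz⟩ := Metric.mem_closure_iff.1 (hs c hc) δ hδ
    obtain ⟨-, D, hD⟩ := hUΩ hz
    refine ⟨1 + D, fun v hv => ?_⟩
    have := dist_triangle (v c) (v z) (v x₀)
    linarith [heq v hv c (hs c hc) z (subset_closure hz) hcz, hD v hv]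
  choose! D hD using hfin
  have hbound : ∀ v, IsSegmentLip (closure Ω) v → ∀ x ∈ closure Ω,
      dist (v x) (v x₀) ≤ 1 + ∑ c ∈ s, |D c| := by
    intro v hv x hx
    obtain ⟨c, hc, hxc⟩ := mem_iUnion₂.1 (hcov hx)
    have h1 := heq v hv x hx c (hs c hc) (lt_trans hxc (half_lt_self hδ))
    have h2 := (hD c hc v hv).trans ((le_abs_self _).trans
      (Finset.single_le_sum (f := fun c => |D c|) (fun _ _ => abs_nonneg _) hc))
    have := dist_triangle (v x) (v c) (v x₀)
    linarith
  refine ⟨2 * (1 + ∑ c ∈ s, |D c|), fun v hv x hx y hy => ?_⟩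
  have := dist_triangle_right (v x) (v y) (v x₀)
  linarith [hbound v hv x hx, hbound v hv y hy]

/-! ### Geodesic Lipschitz constants and gradient bounds -/

/-- A function that is locally `M`-Lipschitz near every point of `K` is `M`-Lipschitz for the
geodesic distance of `K`. -/
theorem edist_le_mul_geodesicEDist_of_locally {K : Set (EuclideanSpace ℝ (Fin N))}
    {f : EuclideanSpace ℝ (Fin N) → ℝ} {M : ℝ≥0} (hM : M ≠ 0)
    (hf : ∀ z ∈ K, ∃ t ∈ 𝓝 z, LipschitzOnWith M f t) (x y : EuclideanSpace ℝ (Fin N)) :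
    edist (f x) (f y) ≤ M * geodesicEDist K x y := by
  unfold geodesicEDist
  simp_rw [ENNReal.mul_iInf_of_ne (ENNReal.coe_ne_zero.2 hM) ENNReal.coe_ne_top]
  refine le_iInf₂ fun γ hγ => ?_
  choose! U hU hlip using hf
  -- Subdivide the curve so that each piece stays in one neighbourhood where `f` is `M`-Lipschitz.
  obtain ⟨t, ht0, htm, ⟨n, hn⟩, hsub⟩ :=
    exists_monotone_Icc_subset_open_cover_unitInterval
      (c := fun s : unitInterval => γ ⁻¹' interior (U (γ s)))
      (fun s => isOpen_interior.preimage γ.continuous)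
      (fun s _ => mem_iUnion.2 ⟨s, mem_interior_iff_mem_nhds.2 (hU _ (hγ s))⟩)
  have h1 := edist_le_range_sum_edist (fun i => f (γ (t i))) n
  simp only [ht0, hn n le_rfl, γ.source, γ.target] at h1
  refine h1.trans ?_
  calc ∑ i ∈ Finset.range n, edist (f (γ (t i))) (f (γ (t (i + 1))))
      ≤ ∑ i ∈ Finset.range n, M * edist (γ (t (i + 1))) (γ (t i)) := by
        refine Finset.sum_le_sum fun i _ => ?_
        obtain ⟨s, hs⟩ := hsub i
        rw [edist_comm (γ (t (i + 1)))]
        exact hlip _ (hγ s) (interior_subset (hs (left_mem_Icc.2 (htm i.le_succ))))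
          (interior_subset (hs (right_mem_Icc.2 (htm i.le_succ))))
    _ = M * ∑ i ∈ Finset.range n, edist (γ (t (i + 1))) (γ (t i)) := by rw [Finset.mul_sum]
    _ ≤ M * eVariationOn γ univ := by
        gcongr
        exact eVariationOn.sum_le htm fun i => mem_univ _

/-- A `C¹` function whose derivative is bounded by `M` on `K` is `M`-Lipschitz for the geodesic
distance of `K`. -/
theorem edist_le_mul_geodesicEDist_of_norm_fderiv_le {K : Set (EuclideanSpace ℝ (Fin N))}
    {f : EuclideanSpace ℝ (Fin N) → ℝ} (hf : ContDiff ℝ 1 f) {M : ℝ≥0} (hM : M ≠ 0)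
    (hfM : ∀ z ∈ K, ‖fderiv ℝ f z‖ ≤ M) (x y : EuclideanSpace ℝ (Fin N)) :
    edist (f x) (f y) ≤ M * geodesicEDist K x y := by
  -- A local Lipschitz constant is available only strictly above the derivative norm, so `M'`
  -- decreases to `M`. In this limit `M ≠ 0` covers an infinite geodesic distance.
  have hlt : ∀ M' : ℝ≥0, M < M' → edist (f x) (f y) ≤ M' * geodesicEDist K x y := by
    intro M' hM'
    refine edist_le_mul_geodesicEDist_of_locally (pos_of_gt hM').ne' (fun z hz => ?_) x y
    exact hf.contDiffAt.exists_lipschitzOnWith_of_nnnorm_lt M' ((hfM z hz).trans_lt hM')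
  have hlim : Tendsto (fun M' : ℝ≥0 => (M' : ℝ≥0∞) * geodesicEDist K x y) (𝓝[>] M)
      (𝓝 (M * geodesicEDist K x y)) :=
    (ENNReal.Tendsto.mul_const (ENNReal.tendsto_coe.2 tendsto_id)
      (Or.inl (ENNReal.coe_ne_zero.2 hM))).mono_left nhdsWithin_le_nhds
  exact ge_of_tendsto hlim (eventually_mem_nhdsWithin.mono hlt)

theorem norm_gradient_eq (f : EuclideanSpace ℝ (Fin N) → ℝ) (x : EuclideanSpace ℝ (Fin N)) :
    ‖∇ f x‖ = ‖fderiv ℝ f x‖ := by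
  simp [gradient]

theorem geodesicEDist_le_of_segment_subset {K : Set (EuclideanSpace ℝ (Fin N))}
    {x y : EuclideanSpace ℝ (Fin N)} (h : segment ℝ x y ⊆ K) :
    geodesicEDist K x y ≤ edist x y := by
  rw [← geodesicEDist_eq_edist (convex_segment x y) (left_mem_segment ℝ x y)
    (right_mem_segment ℝ x y)]
  exact le_iInf₂ fun γ hγ => iInf₂_le γ fun t => h (hγ t)

/-- A segment in the closure is itself an admissible curve. The zero values outside the closure play
no role. -/
theorem isSegmentLip_of_mem_lipOne {Ω : Set (EuclideanSpace ℝ (Fin N))} {u : LipFun Ω}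
    (hu : u ∈ LipOne Ω) : IsSegmentLip (closure Ω) (Function.extend Subtype.val u.1 0) := by
  intro x y hxy
  have hx := hxy (left_mem_segment ℝ x y)
  have hy := hxy (right_mem_segment ℝ x y)
  have h := hu ⟨x, hx⟩ ⟨y, hy⟩
  have hex : ∀ z (hz : z ∈ closure Ω), Function.extend Subtype.val u.1 0 z = u.1 ⟨z, hz⟩ :=
    fun z hz => Subtype.val_injective.extend_apply u.1 0 ⟨z, hz⟩
  rw [hex x hx, hex y hy, ← ENNReal.ofReal_le_ofReal_iff dist_nonneg, ← edist_dist, ← edist_dist]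
  exact h.trans (geodesicEDist_le_of_segment_subset hxy)

/-- The gradient of a test function that is 1-Lipschitz for the geodesic distance has norm at most
one on the closure of the domain. -/
theorem norm_gradient_le_one {Ω : Set (EuclideanSpace ℝ (Fin N))} (hΩ : IsOpen Ω)
    {φ : 𝓓((⊤ : TopologicalSpace.Opens (EuclideanSpace ℝ (Fin N))), ℝ)}
    (hφ : restrictTest Ω φ ∈ LipOne Ω) {x : EuclideanSpace ℝ (Fin N)} (hx : x ∈ closure Ω) :
    ‖∇ φ x‖ ≤ 1 := by
  have hcont : Continuous fun x => ‖fderiv ℝ φ x‖ :=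
    (φ.contDiff.continuous_fderiv (by simp)).norm
  rw [norm_gradient_eq]
  refine closure_minimal (fun z hz => ?_) (isClosed_le hcont continuous_const) hx
  obtain ⟨δ, hδ, hball⟩ := Metric.isOpen_iff.1 hΩ z hz
  refine norm_fderiv_le_of_lipschitzOn ℝ (C := 1) (Metric.ball_mem_nhds z hδ) fun a ha b hb => ?_
  rw [ENNReal.coe_one, one_mul]
  refine (hφ ⟨a, subset_closure (hball ha)⟩ ⟨b, subset_closure (hball hb)⟩).trans ?_
  exact geodesicEDist_le_of_segment_subset
    (((convex_ball z δ).segment_subset ha hb).trans (hball.trans subset_closure))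

/-! ### Approximation by test functions -/

open scoped Convolution in
/-- Mollification of a function that is 1-Lipschitz along the segments in an open set. -/
theorem exists_smooth_approx {Ω : Set (EuclideanSpace ℝ (Fin N))} (hΩ : IsOpen Ω)
    (hbdd : Bornology.IsBounded Ω) {v : EuclideanSpace ℝ (Fin N) → ℝ}
    (hv : IsSegmentLip Ω v) {B : ℝ} (hB : ∀ x ∈ Ω, |v x| ≤ B) {δ : ℝ} (hδ : 0 < δ) :
    ∃ w : EuclideanSpace ℝ (Fin N) → ℝ, ContDiff ℝ ∞ w ∧ HasCompactSupport w ∧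
      ∀ x, Metric.ball x (2 * δ) ⊆ Ω → ‖fderiv ℝ w x‖ ≤ 1 ∧ dist (w x) (v x) ≤ δ := by
  set g : EuclideanSpace ℝ (Fin N) → ℝ := Ω.indicator v with hg
  have hgmeas : AEStronglyMeasurable g volume := by
    rw [hg, aestronglyMeasurable_indicator_iff hΩ.measurableSet]
    refine ContinuousOn.aestronglyMeasurable (fun x hx => ?_) hΩ.measurableSet
    obtain ⟨r, hr, hball⟩ := Metric.isOpen_iff.1 hΩ x hx
    have h : LipschitzOnWith 1 v (Metric.ball x r) := LipschitzOnWith.of_dist_le_mul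
      fun a ha b hb => by simpa using hv.dist_le_of_ball hball ha hb
    exact (h.continuousOn.continuousAt (Metric.ball_mem_nhds x hr)).continuousWithinAt
  have hgB : ∀ x, ‖g x‖ ≤ |B| := fun x => by
    by_cases hx : x ∈ Ω
    · simpa [hg, hx] using (hB x hx).trans (le_abs_self B)
    · simp [hg, hx]
  have hgint : Integrable g volume := by
    refine IntegrableOn.integrable_of_forall_notMem_eq_zero (s := Ω) ?_ fun x hx => by simp [hg, hx]
    exact Measure.integrableOn_of_bounded hbdd.measure_lt_top.ne hgmeas (M := |B|)
      (Eventually.of_forall hgB)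
  have hgsupp : HasCompactSupport g :=
    HasCompactSupport.of_support_subset_isCompact hbdd.isCompact_closure
      (support_indicator_subset.trans subset_closure)
  let ρ : ContDiffBump (0 : EuclideanSpace ℝ (Fin N)) := ⟨δ / 2, δ, half_pos hδ, half_lt_self hδ⟩
  set k := ρ.normed volume with hk
  refine ⟨k ⋆[ContinuousLinearMap.lsmul ℝ ℝ, volume] g, ?_, ?_, fun x hx => ⟨?_, ?_⟩⟩
  · exact ρ.hasCompactSupport_normed.contDiff_convolution_left _ ρ.contDiff_normed
      hgint.locallyIntegrable
  · exact ρ.hasCompactSupport_normed.convolution _ hgsupp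
  · refine norm_fderiv_le_of_lipschitzOn ℝ (C := 1) (Metric.ball_mem_nhds x hδ) ?_
    refine LipschitzOnWith.of_dist_le_mul fun a ha b hb => ?_
    have hex : ConvolutionExists k g (ContinuousLinearMap.lsmul ℝ ℝ) volume :=
      ρ.hasCompactSupport_normed.convolutionExists_left _ ρ.continuous_normed
        hgint.locallyIntegrable
    rw [dist_eq_norm, convolution_def, convolution_def, ← integral_sub (hex a) (hex b),
      NNReal.coe_one, one_mul]
    have hkint : ∫ t, k t * dist a b = dist a b := by
      rw [integral_mul_const, ρ.integral_normed, one_mul]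
    rw [← hkint]
    refine norm_integral_le_of_norm_le (ρ.integrable_normed.mul_const _)
      (Eventually.of_forall fun t => ?_)
    rw [← map_sub, ContinuousLinearMap.lsmul_apply, norm_smul,
      Real.norm_of_nonneg (ρ.nonneg_normed t)]
    rcases eq_or_ne (k t) 0 with h0 | h0
    · change k t * _ ≤ k t * _
      simp [h0]
    have ht : ‖t‖ < δ := by
      have : t ∈ Function.support (ρ.normed volume) := h0
      rw [ρ.support_normed_eq] at this
      simpa [ρ] using this
    -- One `δ` accounts for the point near `x`, the other for the shift by `t` in the support of the
    -- kernel; hence the radius `2 * δ`.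
    have hmem : ∀ y ∈ Metric.ball x δ, y - t ∈ Metric.ball x (2 * δ) := fun y hy => by
      rw [Metric.mem_ball, dist_eq_norm] at hy ⊢
      calc ‖y - t - x‖ = ‖(y - x) - t‖ := by congr 1; abel
        _ ≤ ‖y - x‖ + ‖t‖ := norm_sub_le _ _
        _ < 2 * δ := by linarith
    refine mul_le_mul_of_nonneg_left ?_ (ρ.nonneg_normed t)
    rw [hg, indicator_of_mem (hx (hmem a ha)), indicator_of_mem (hx (hmem b hb)), ← dist_eq_norm]
    simpa using hv.dist_le_of_ball hx (hmem a ha) (hmem b hb)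
  · have hxΩ : x ∈ Ω := hx (Metric.mem_ball_self (by positivity))
    have hgx : g x = v x := indicator_of_mem hxΩ v
    rw [← hgx]
    refine ρ.dist_normed_convolution_le hgmeas fun y hy => ?_
    have hyb : y ∈ Metric.ball x (2 * δ) := Metric.ball_subset_ball (by simp [ρ]; linarith) hy
    rw [hgx, hg, indicator_of_mem (hx hyb)]
    exact (hv.dist_le_of_ball hx hyb (Metric.mem_ball_self (by positivity))).trans hy.le

/-- Functions that are 1-Lipschitz along segments are uniform limits, on the closure of a Lipschitz
domain, of test functions whose derivatives are almost bounded by one there. -/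
theorem exists_test_approx {Ω : Set (EuclideanSpace ℝ (Fin N))} (hΩ : IsOpen Ω)
    (hbdd : Bornology.IsBounded Ω) (hlip : HasLipschitzBoundary Ω)
    {v : EuclideanSpace ℝ (Fin N) → ℝ} (hv : IsSegmentLip (closure Ω) v) {B : ℝ}
    (hB : ∀ x ∈ closure Ω, |v x| ≤ B) {ε : ℝ≥0} (hε : 0 < ε) :
    ∃ φ : 𝓓((⊤ : TopologicalSpace.Opens (EuclideanSpace ℝ (Fin N))), ℝ),
      ∀ x ∈ closure Ω, ‖fderiv ℝ φ x‖ ≤ 1 + ε ∧ dist (φ x) (v x) ≤ 2 * ε := by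
  have hε' : (0 : ℝ) < ε := hε
  obtain ⟨T, hT1, hT2, hT3, hT4, hT5⟩ := exists_push hΩ hbdd hlip hε
  obtain ⟨δ, hδ, hball⟩ := exists_ball_subset_of_push hΩ hbdd hT1.continuous hT4
  -- The scale is at most `δ / 2` so that the doubled ball fits in `Ω`, and at most `ε` to control
  -- the mollification error.
  obtain ⟨w, hw1, hw2, hw3⟩ := exists_smooth_approx hΩ hbdd
    (fun x y h => hv x y (h.trans subset_closure)) (fun x hx => hB x (subset_closure hx))
    (δ := min (δ / 2) ε) (by positivity)
  have hsub : ∀ x ∈ closure Ω, Metric.ball (T x) (2 * min (δ / 2) ε) ⊆ Ω := fun x hx =>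
    (Metric.ball_subset_ball (by linarith [min_le_left (δ / 2) (ε : ℝ)])).trans (hball x hx)
  have hsupp : HasCompactSupport (w ∘ T) := by
    obtain ⟨R, hR⟩ := hw2.isCompact.isBounded.subset_closedBall 0
    refine HasCompactSupport.of_support_subset_isCompact
      (isCompact_closedBall (0 : EuclideanSpace ℝ (Fin N)) (R + ε)) fun x hx => ?_
    have h1 : T x ∈ Metric.closedBall 0 R := hR (subset_tsupport w hx)
    rw [Metric.mem_closedBall] at h1 ⊢
    have := dist_triangle_left x 0 (T x)
    linarith [hT3 x]
  refine ⟨⟨w ∘ T, hw1.comp hT1, hsupp, by simp⟩, fun x hx => ⟨?_, ?_⟩⟩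
  · have hd : fderiv ℝ (w ∘ T) x = (fderiv ℝ w (T x)).comp (fderiv ℝ T x) :=
      fderiv_comp x (hw1.differentiable (by simp) _) (hT1.differentiable (by simp) _)
    have h1 := (hw3 (T x) (hsub x hx)).1
    have h2 : ‖fderiv ℝ T x‖ ≤ 1 + ε := by simpa using norm_fderiv_le_of_lipschitz ℝ hT2 (x₀ := x)
    rw [TestFunction.coe_mk, hd]
    calc _ ≤ ‖fderiv ℝ w (T x)‖ * ‖fderiv ℝ T x‖ := ContinuousLinearMap.opNorm_comp_le _ _
      _ ≤ 1 * (1 + ε) := by gcongr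
      _ = 1 + ε := one_mul _
  · rw [TestFunction.coe_mk, Function.comp_apply]
    have h1 := (hw3 (T x) (hsub x hx)).2
    have := dist_triangle (w (T x)) (v (T x)) (v x)
    linarith [hT5 v hv x hx, min_le_right (δ / 2) (ε : ℝ)]

/-! ### Integration against signed measures -/

section Pairing

variable {X : Type*} [MeasurableSpace X]

instance isFiniteMeasure_variation (ν : SignedMeasure X) : IsFiniteMeasure ν.variation := by
  rw [← SignedMeasure.totalVariation_eq_variation]
  infer_instance

theorem abs_pairing_le (ν : SignedMeasure X) {u : X → ℝ} {c : ℝ} (hu : ∀ x, |u x| ≤ c) :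
    |pairing ν u| ≤ c * ν.variation.real univ := by
  have h := VectorMeasure.norm_integral_le_of_norm_le_const (μ := ν)
    (B := ContinuousLinearMap.lsmul ℝ ℝ) (f := u) (Eventually.of_forall hu)
  simpa [pairing] using h

theorem pairing_sub (ν : SignedMeasure X) {u v : X → ℝ} (hu : Integrable u ν.variation)
    (hv : Integrable v ν.variation) :
    pairing ν (fun x => u x - v x) = pairing ν u - pairing ν v :=
  VectorMeasure.integral_fun_sub hu hv

theorem pairing_const (ν : SignedMeasure X) (c : ℝ) : pairing ν (fun _ => c) = c * ν univ := by
  simp [pairing, VectorMeasure.integral_const]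

/-- Reduces integrals to values of the measure on sets, where the matrix inequalities are available;
`tendsto_pairing_approxBounded` then passes to the limit. -/
theorem pairing_comp_simpleFunc (ν : SignedMeasure X) {F : Type*} (p : SimpleFunc X F)
    (h : F → ℝ) : pairing ν (fun x => h (p x)) = ∑ y ∈ p.range, h y * ν (p ⁻¹' {y}) := by
  classical
  have h1 : (fun x => h (p x)) =
      fun x => ∑ y ∈ p.range, (p ⁻¹' {y}).indicator (fun _ => h y) x := by
    ext x
    rw [Finset.sum_eq_single (p x)]
    · simp
    · intro y _ hy
      exact indicator_of_notMem (by simpa using hy.symm) _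
    · simp
  rw [h1, pairing, VectorMeasure.integral_finsetSum]
  · refine Finset.sum_congr rfl fun y _ => ?_
    rw [VectorMeasure.integral_indicator_const]
    · simp
    · exact p.measurableSet_fiber y
  · intro y _
    exact (integrable_const _).indicator (p.measurableSet_fiber y)

theorem tendsto_pairing_approxBounded (ν : SignedMeasure X) {F : Type*} [NormedAddCommGroup F]
    [NormedSpace ℝ F] [ProperSpace F] {p : X → F} (hp : StronglyMeasurable p) {c : ℝ}
    (hc : 0 ≤ c) (hpc : ∀ x, ‖p x‖ ≤ c) {h : F → ℝ} (hh : Continuous h) :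
    Tendsto (fun n => pairing ν (fun x => h (hp.approxBounded c n x))) atTop
      (𝓝 (pairing ν (fun x => h (p x)))) := by
  obtain ⟨B, hB⟩ := (isCompact_closedBall (0 : F) c).exists_bound_of_continuousOn hh.continuousOn
  refine VectorMeasure.tendsto_integral_of_dominated_convergence (fun _ => B) (fun n => ?_)
    (integrable_const B) (fun n => Eventually.of_forall fun x => ?_)
    (Eventually.of_forall fun x => ?_)
  · exact (hh.comp_stronglyMeasurable (SimpleFunc.stronglyMeasurable _)).aestronglyMeasurable
  · exact hB _ (by simpa using hp.norm_approxBounded_le hc n x)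
  · exact (hh.tendsto _).comp (hp.tendsto_approxBounded_of_norm_le (hpc x))

/-- Integration against a signed measure with a density. -/
theorem pairing_withDensity {μ : Measure X} {f : X → ℝ} (hf : Integrable f μ)
    {g : X → ℝ} (hg : StronglyMeasurable g) {c : ℝ} (hc : 0 ≤ c) (hgc : ∀ x, ‖g x‖ ≤ c) :
    pairing (μ.withDensityᵥ f) g = ∫ x, g x * f x ∂μ := by
  have h1 := tendsto_pairing_approxBounded (μ.withDensityᵥ f) hg hc hgc continuous_id
  have h2 : Tendsto (fun n => ∫ x, hg.approxBounded c n x * f x ∂μ) atTop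
      (𝓝 (∫ x, g x * f x ∂μ)) := by
    refine tendsto_integral_of_dominated_convergence (fun x => c * ‖f x‖) (fun n => ?_)
      (hf.norm.const_mul c) (fun n => Eventually.of_forall fun x => ?_)
      (Eventually.of_forall fun x => ?_)
    · exact (SimpleFunc.stronglyMeasurable _).aestronglyMeasurable.mul hf.1
    · rw [norm_mul]
      gcongr
      exact hg.norm_approxBounded_le hc n x
    · exact (hg.tendsto_approxBounded_of_norm_le (hgc x)).mul_const _
  refine tendsto_nhds_unique h1 (h2.congr fun n => ?_)
  set p := hg.approxBounded c n
  change _ = pairing _ (fun x => id (p x))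
  rw [pairing_comp_simpleFunc]
  have h3 : (fun x => p x * f x) =
      fun x => ∑ y ∈ p.range, y * (p ⁻¹' {y}).indicator f x := by
    ext x
    rw [Finset.sum_eq_single (p x)]
    · simp
    · intro y _ hy
      rw [indicator_of_notMem (by simpa using hy.symm), mul_zero]
    · simp
  rw [h3, integral_finsetSum]
  · refine Finset.sum_congr rfl fun y _ => ?_
    rw [integral_const_mul, integral_indicator (p.measurableSet_fiber y),
      withDensityᵥ_apply hf (p.measurableSet_fiber y), id]
  · intro y _
    exact (hf.indicator (p.measurableSet_fiber y)).const_mul y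

end Pairing

/-! ### Bounding the energy by the trace -/

/-- Decompose `A` into terms `w wᵀ`: each contributes `(w · y)² ≤ |w|² |y|²`, and the trace is the
sum of the `|w|²`. -/
theorem sum_mul_mul_le_trace {A : Matrix (Fin N) (Fin N) ℝ} (hA : A.PosSemidef)
    {y : EuclideanSpace ℝ (Fin N)} (hy : ‖y‖ ≤ 1) : ∑ i, ∑ j, y i * y j * A i j ≤ A.trace := by
  obtain ⟨m, w, rfl⟩ := Matrix.posSemidef_iff_eq_sum_vecMulVec.1 hA
  have hy' : ∑ j, y j ^ 2 ≤ 1 := by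
    rw [← EuclideanSpace.real_norm_sq_eq]
    exact pow_le_one₀ (norm_nonneg y) hy
  have h1 : ∑ i, ∑ j, y i * y j * (∑ k, Matrix.vecMulVec (w k) (star (w k))) i j =
      ∑ k, (∑ i, w k i * y i) ^ 2 := by
    simp only [Matrix.sum_apply, Matrix.vecMulVec_apply, star_trivial, sq, Finset.mul_sum]
    simp_rw [Finset.sum_comm (t := (Finset.univ : Finset (Fin m)))]
    refine Finset.sum_congr rfl fun k _ => Finset.sum_congr rfl fun i _ => ?_
    rw [Finset.sum_mul]
    exact Finset.sum_congr rfl fun j _ => by ring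
  have h2 : (∑ k, Matrix.vecMulVec (w k) (star (w k))).trace = ∑ k, ∑ i, w k i ^ 2 := by
    rw [Matrix.trace_sum]
    simp [Matrix.trace, Matrix.vecMulVec_apply, sq]
  rw [h1, h2]
  refine Finset.sum_le_sum fun k _ => ?_
  refine (Finset.sum_mul_sq_le_sq_mul_sq _ _ _).trans ?_
  exact mul_le_of_le_one_right (Finset.sum_nonneg fun _ _ => sq_nonneg _) hy'

theorem TensorMeasure.entry_apply {Ω : Set (EuclideanSpace ℝ (Fin N))} (C : TensorMeasure Ω)
    (i j : Fin N) (s : Set (closure Ω)) : C.entry i j s = C s i j := rfl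

/-- For simple `p`, apply `sum_mul_mul_le_trace` to the value of `C` on each fibre; the traces add
up to that of `C univ`. No density of `C` is needed. -/
theorem sum_pairing_entry_le {Ω : Set (EuclideanSpace ℝ (Fin N))} {C : TensorMeasure Ω}
    (hC : ∀ s, MeasurableSet s → (C s).PosSemidef) {p : closure Ω → EuclideanSpace ℝ (Fin N)}
    (hp : StronglyMeasurable p) (hp1 : ∀ x, ‖p x‖ ≤ 1) :
    ∑ i, ∑ j, pairing (C.entry i j) (fun x => p x i * p x j) ≤ (C univ).trace := by
  have hlim : Tendsto (fun n => ∑ i, ∑ j, pairing (C.entry i j)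
      (fun x => hp.approxBounded 1 n x i * hp.approxBounded 1 n x j)) atTop
      (𝓝 (∑ i, ∑ j, pairing (C.entry i j) (fun x => p x i * p x j))) :=
    tendsto_finsetSum _ fun i _ => tendsto_finsetSum _ fun j _ =>
      tendsto_pairing_approxBounded (C.entry i j) hp zero_le_one hp1
        (h := fun y => y i * y j) (by fun_prop)
  refine le_of_tendsto hlim (Eventually.of_forall fun n => ?_)
  set q := hp.approxBounded 1 n
  have hq : ∀ y ∈ q.range, ‖y‖ ≤ 1 := by
    intro y hy
    obtain ⟨x, rfl⟩ := SimpleFunc.mem_range.1 hy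
    exact hp.norm_approxBounded_le zero_le_one n x
  have h1 : ∑ i, ∑ j, pairing (C.entry i j) (fun x => q x i * q x j) =
      ∑ y ∈ q.range, ∑ i, ∑ j, y i * y j * C (q ⁻¹' {y}) i j := by
    rw [Finset.sum_comm]
    simp_rw [fun i j => pairing_comp_simpleFunc (C.entry i j) q (fun y => y i * y j),
      TensorMeasure.entry_apply]
    rw [Finset.sum_comm]
    simp_rw [Finset.sum_comm (s := Finset.univ) (t := q.range)]
  have h2 : (C univ).trace = ∑ y ∈ q.range, (C (q ⁻¹' {y})).trace := by
    simp only [Matrix.trace, Matrix.diag]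
    rw [Finset.sum_comm]
    refine Finset.sum_congr rfl fun i _ => ?_
    have := pairing_comp_simpleFunc (C.entry i i) q (fun _ => 1)
    rw [pairing_const] at this
    simpa [TensorMeasure.entry_apply] using this
  rw [h1, h2]
  exact Finset.sum_le_sum fun y hy =>
    sum_mul_mul_le_trace (hC _ (q.measurableSet_fiber y)) (hq y hy)

theorem continuous_gradient (φ : 𝓓((⊤ : TopologicalSpace.Opens (EuclideanSpace ℝ (Fin N))), ℝ)) :
    Continuous (∇ φ : EuclideanSpace ℝ (Fin N) → EuclideanSpace ℝ (Fin N)) := by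
  unfold gradient
  exact (LinearIsometryEquiv.continuous _).comp (φ.contDiff.continuous_fderiv (by simp))

theorem tensorEnergy_le {Ω : Set (EuclideanSpace ℝ (Fin N))} {C : TensorMeasure Ω} {Λ₀ : ℝ}
    (hC : C ∈ admissibleTensors Ω Λ₀)
    {φ : 𝓓((⊤ : TopologicalSpace.Opens (EuclideanSpace ℝ (Fin N))), ℝ)}
    (hφ : ∀ x ∈ closure Ω, ‖∇ φ x‖ ≤ 1) : tensorEnergy C φ ≤ Λ₀ :=
  (sum_pairing_entry_le hC.1 (p := fun x : closure Ω => ∇ φ (x : EuclideanSpace ℝ (Fin N)))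
    ((continuous_gradient φ).comp continuous_subtype_val).stronglyMeasurable
    fun x => hφ x x.2).trans hC.2

/-! ### Representation by Hahn–Banach and Riesz -/

section Representation

open scoped Pointwise

variable {V : Type*} [AddCommGroup V] [Module ℝ V] {X : Type*} [TopologicalSpace X]
  [CompactSpace X] {F : Type*} [NormedAddCommGroup F] [NormedSpace ℝ F]

/-- A linear functional dominated by a sup norm is dominated by a positive functional applied to
the pointwise norm. -/
theorem exists_positive_functional [Nonempty X] (G : V →ₗ[ℝ] C(X, F)) (q : V →ₗ[ℝ] ℝ) {I : ℝ}
    (hI : 0 ≤ I) (hq : ∀ φ, q φ ≤ I * ‖G φ‖) :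
    ∃ Φ : C(X, ℝ) →ₗ[ℝ] ℝ, (∀ f, 0 ≤ f → 0 ≤ Φ f) ∧ Φ 1 ≤ I ∧
      ∀ φ (f : C(X, ℝ)), (∀ x, f x = ‖G φ x‖) → q φ ≤ Φ f := by
  -- The infimum of `A f` is sublinear in `f`, and `Φ` is a linear functional below it. Evaluating
  -- at `-f` with `c = 0` gives positivity (`φ = 0`) and domination of `q` (`f = ‖G φ‖`); evaluating
  -- at `1` with `c = 1`, `φ = 0` gives `Φ 1 ≤ I`.
  let A : C(X, ℝ) → Set ℝ := fun f =>
    {a | ∃ (c : ℝ) (φ : V), (∀ x, f x + ‖G φ x‖ ≤ c) ∧ a = I * c - q φ}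
  have hmem : ∀ (f : C(X, ℝ)) (c : ℝ) (φ : V), (∀ x, f x + ‖G φ x‖ ≤ c) → I * c - q φ ∈ A f :=
    fun f c φ h => ⟨c, φ, h, rfl⟩
  have hne : ∀ f, (A f).Nonempty := fun f => ⟨_, hmem f ‖f‖ 0 fun x => by
    simpa using (le_abs_self _).trans (f.norm_coe_le_norm x)⟩
  have hlow : ∀ f, ∀ a ∈ A f, -(I * ‖f‖) ≤ a := by
    rintro f _ ⟨c, φ, h, rfl⟩
    have h1 : ∀ x, ‖G φ x‖ ≤ c + ‖f‖ := fun x => by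
      have := (neg_le_abs _).trans (f.norm_coe_le_norm x)
      linarith [h x]
    have h2 : ‖G φ‖ ≤ c + ‖f‖ := (ContinuousMap.norm_le_of_nonempty _).2 h1
    nlinarith [hq φ, mul_le_mul_of_nonneg_left h2 hI]
  have hbdd : ∀ f, BddBelow (A f) := fun f => ⟨_, hlow f⟩
  have hle : ∀ (f : C(X, ℝ)) (c : ℝ) (φ : V), (∀ x, f x + ‖G φ x‖ ≤ c) →
      sInf (A f) ≤ I * c - q φ := fun f c φ h => csInf_le (hbdd f) (hmem f c φ h)
  have hsmul : ∀ c : ℝ, 0 < c → ∀ f a, a ∈ A f → c * a ∈ A (c • f) := by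
    rintro c hc f _ ⟨b, φ, h, rfl⟩
    refine ⟨c * b, c • φ, fun x => ?_, by simp; ring⟩
    have := mul_le_mul_of_nonneg_left (h x) hc.le
    simpa [norm_smul, abs_of_pos hc, mul_add] using this
  have hhom : ∀ c : ℝ, 0 < c → ∀ f, sInf (A (c • f)) = c * sInf (A f) := by
    intro c hc f
    have : A (c • f) = c • A f := by
      ext a
      rw [mem_smul_set]
      constructor
      · intro ha
        refine ⟨c⁻¹ * a, ?_, by simp [hc.ne']⟩
        simpa [smul_smul, hc.ne'] using hsmul c⁻¹ (inv_pos.2 hc) (c • f) a ha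
      · rintro ⟨b, hb, rfl⟩
        exact hsmul c hc f b hb
    rw [this, Real.sInf_smul_of_nonneg hc.le, smul_eq_mul]
  have hadd : ∀ f g, sInf (A (f + g)) ≤ sInf (A f) + sInf (A g) := by
    intro f g
    rw [← csInf_add (hne f) (hbdd f) (hne g) (hbdd g)]
    refine csInf_le_csInf (hbdd _) ((hne f).add (hne g)) ?_
    rintro _ ⟨_, ⟨c, φ, h, rfl⟩, _, ⟨d, ψ, k, rfl⟩, rfl⟩
    refine ⟨c + d, φ + ψ, fun x => ?_, by simp; ring⟩
    have := norm_add_le (G φ x) (G ψ x)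
    simp only [map_add, ContinuousMap.add_apply]
    linarith [h x, k x]
  have hzero : 0 ≤ sInf (A 0) :=
    le_csInf (hne 0) fun a ha => by simpa using hlow 0 a ha
  obtain ⟨Φ, -, hΦ⟩ := exists_extension_of_le_sublinear (E := C(X, ℝ)) ⟨⊥, 0⟩
    (fun f => sInf (A f)) hhom hadd (by
      rintro ⟨f, hf⟩
      obtain rfl : f = 0 := by simpa using hf
      exact hzero)
  refine ⟨Φ, fun f hf => ?_, ?_, fun φ f hf => ?_⟩
  · have h := (hΦ (-f)).trans (hle (-f) 0 0 fun x => by simpa using hf x)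
    simpa using h
  · simpa using (hΦ 1).trans (hle 1 1 0 fun x => by simp)
  · have h := (hΦ (-f)).trans (hle (-f) 0 φ fun x => by simp [hf x])
    simpa using h

open CompactlySupported in
/-- A linear functional dominated by a sup norm is dominated by an integral of the pointwise
norm. -/
theorem exists_dominating_measure [Nonempty X] [T2Space X] [MeasurableSpace X] [BorelSpace X]
    (G : V →ₗ[ℝ] C(X, F)) (q : V →ₗ[ℝ] ℝ) {I : ℝ} (hI : 0 ≤ I) (hq : ∀ φ, q φ ≤ I * ‖G φ‖) :
    ∃ μ : Measure X, IsFiniteMeasure μ ∧ μ.real univ ≤ I ∧ ∀ φ, q φ ≤ ∫ x, ‖G φ x‖ ∂μ := by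
  obtain ⟨Φ, hpos, hone, hΦ⟩ := exists_positive_functional G q hI hq
  let L : C_c(X, ℝ) →ₗ[ℝ] ℝ :=
    { toFun := fun f => Φ f.toContinuousMap
      map_add' := fun f g => Φ.map_add f.toContinuousMap g.toContinuousMap
      map_smul' := fun c f => Φ.map_smul c f.toContinuousMap }
  let Λ : C_c(X, ℝ) →ₚ[ℝ] ℝ := PositiveLinearMap.mk₀ L fun f hf => hpos _ hf
  have hrep : ∀ f : C(X, ℝ), ∫ x, f x ∂(RealRMK.rieszMeasure Λ) = Φ f := fun f =>
    RealRMK.integral_rieszMeasure Λ ⟨f, HasCompactSupport.of_compactSpace _⟩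
  refine ⟨RealRMK.rieszMeasure Λ, inferInstance, ?_, fun φ => ?_⟩
  · have := hrep 1
    simp only [ContinuousMap.one_apply, integral_const, smul_eq_mul, mul_one] at this
    rwa [this]
  · let f : C(X, ℝ) := ⟨fun x => ‖G φ x‖, by fun_prop⟩
    exact (hΦ φ f fun x => rfl).trans_eq (hrep f).symm

/-- A linear functional controlled by a linear map into a Hilbert space is an inner product. -/
theorem exists_inner_representation {H : Type*} [NormedAddCommGroup H] [InnerProductSpace ℝ H]
    [CompleteSpace H] (A : V →ₗ[ℝ] H) (q : V →ₗ[ℝ] ℝ) {c : ℝ} (hc : 0 ≤ c)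
    (hq : ∀ φ, |q φ| ≤ c * ‖A φ‖) : ∃ θ : H, ‖θ‖ ≤ c ∧ ∀ φ, q φ = inner ℝ θ (A φ) := by
  obtain ⟨s, hs⟩ := A.rangeRestrict.exists_rightInverse_of_surjective A.range_rangeRestrict
  have hs' : ∀ y, A (s y) = y := fun y => congrArg Subtype.val (LinearMap.congr_fun hs y)
  let f : LinearMap.range A →L[ℝ] ℝ := (q.comp s).mkContinuous c fun y => by
    simpa [hs'] using hq (s y)
  obtain ⟨g, hg, hgn⟩ := exists_extension_norm_eq (LinearMap.range A) f
  refine ⟨(InnerProductSpace.toDual ℝ H).symm g, ?_, fun φ => ?_⟩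
  · rw [LinearIsometryEquiv.norm_map, hgn]
    exact LinearMap.mkContinuous_norm_le _ hc _
  · rw [InnerProductSpace.toDual_symm_apply]
    have h1 := hg ⟨A φ, LinearMap.mem_range_self A φ⟩
    simp only at h1
    rw [h1]
    -- `φ` and its chosen lift have the same image under `A`, so the bound forces `q` to agree on
    -- them.
    have h2 := hq (φ - s ⟨A φ, LinearMap.mem_range_self A φ⟩)
    rw [map_sub, map_sub, hs'] at h2
    simp only [sub_self, norm_zero, mul_zero] at h2
    exact sub_eq_zero.1 (abs_nonpos_iff.1 h2)

/-- Cauchy–Schwarz against the constant 1, from the discriminant of `t ↦ ∫ (f - t)² dμ`. -/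
theorem sq_integral_le {X : Type*} [MeasurableSpace X] {μ : Measure X} [IsFiniteMeasure μ]
    {f : X → ℝ} (hf : MemLp f 2 μ) : (∫ x, f x ∂μ) ^ 2 ≤ μ.real univ * ∫ x, f x ^ 2 ∂μ := by
  have hf1 : Integrable f μ := hf.integrable (by norm_num)
  have hf2 : Integrable (fun x => f x ^ 2) μ := hf.integrable_sq
  have key : ∀ t : ℝ, 0 ≤ ∫ x, f x ^ 2 ∂μ - 2 * t * ∫ x, f x ∂μ + t ^ 2 * μ.real univ := by
    intro t
    have h0 : 0 ≤ ∫ x, (f x - t) ^ 2 ∂μ := integral_nonneg fun x => sq_nonneg _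
    have h1 : ∫ x, (f x - t) ^ 2 ∂μ = ∫ x, (f x ^ 2 - 2 * t * f x + t ^ 2) ∂μ :=
      integral_congr_ae (Eventually.of_forall fun x => by ring)
    rw [h1, integral_add (f := fun x => f x ^ 2 - 2 * t * f x) (hf2.sub (hf1.const_mul _))
      (integrable_const _), integral_sub hf2 (hf1.const_mul _), integral_const_mul,
      integral_const, smul_eq_mul] at h0
    linarith
  have h := discrim_le_zero (a := μ.real univ) (b := -2 * ∫ x, f x ∂μ) (c := ∫ x, f x ^ 2 ∂μ)
    fun t => by have := key t; linarith
  rw [discrim] at h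
  linarith

/-- A linear functional dominated by a sup norm is an integral against a density. -/
theorem exists_density {F : Type*} [NormedAddCommGroup F] [InnerProductSpace ℝ F]
    [FiniteDimensional ℝ F] [Nonempty X] [T2Space X] [MeasurableSpace X] [BorelSpace X]
    [SecondCountableTopologyEither X F]
    (G : V →ₗ[ℝ] C(X, F)) (q : V →ₗ[ℝ] ℝ) {I : ℝ} (hI : 0 ≤ I) (hq : ∀ φ, q φ ≤ I * ‖G φ‖) :
    ∃ (μ : Measure X) (θ : X → F), IsFiniteMeasure μ ∧ μ.real univ ≤ I ∧ MemLp θ 2 μ ∧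
      ∫ x, ‖θ x‖ ^ 2 ∂μ ≤ I ∧ ∀ φ, q φ = ∫ x, inner ℝ (θ x) (G φ x) ∂μ := by
  obtain ⟨μ, hμ, hμI, hdom⟩ := exists_dominating_measure G q hI hq
  let A : V →ₗ[ℝ] Lp F 2 μ := (ContinuousMap.toLp 2 μ ℝ (E := F)).toLinearMap.comp G
  have hA : ∀ φ, A φ =ᵐ[μ] G φ := fun φ => ContinuousMap.coeFn_toLp μ (G φ)
  have hnorm : ∀ h : Lp F 2 μ, ‖h‖ ^ 2 = ∫ x, ‖h x‖ ^ 2 ∂μ := fun h => by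
    rw [← real_inner_self_eq_norm_sq, L2.inner_def]
    simp
  -- Cauchy–Schwarz turns domination in `L¹(μ)` into a bound in `L²(μ)` whose squared constant is
  -- the mass of `μ`, hence at most `I`.
  have hb : ∀ φ, |q φ| ≤ √(μ.real univ) * ‖A φ‖ := by
    intro φ
    have h1 : |q φ| ≤ ∫ x, ‖G φ x‖ ∂μ := by
      refine abs_le.2 ⟨?_, hdom φ⟩
      have := hdom (-φ)
      simp only [map_neg, ContinuousMap.neg_apply, norm_neg] at this
      linarith
    have h2 : (∫ x, ‖G φ x‖ ∂μ) ^ 2 ≤ μ.real univ * ‖A φ‖ ^ 2 := by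
      rw [hnorm, integral_congr_ae ((hA φ).mono fun x hx => by simp only [hx] :
        (fun x => ‖A φ x‖ ^ 2) =ᵐ[μ] fun x => ‖G φ x‖ ^ 2)]
      refine sq_integral_le ?_
      exact ((memLp_congr_ae (hA φ)).1 (Lp.memLp (A φ))).norm
    refine h1.trans ?_
    rw [← Real.sqrt_sq (norm_nonneg (A φ)), ← Real.sqrt_mul measureReal_nonneg]
    exact Real.le_sqrt_of_sq_le h2
  obtain ⟨θ, hθ, hrep⟩ := exists_inner_representation A q (Real.sqrt_nonneg _) hb
  refine ⟨μ, θ, hμ, hμI, Lp.memLp θ, ?_, fun φ => ?_⟩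
  · rw [← hnorm]
    calc ‖θ‖ ^ 2 ≤ √(μ.real univ) ^ 2 := by gcongr
      _ = μ.real univ := Real.sq_sqrt measureReal_nonneg
      _ ≤ I := hμI
  · rw [hrep, L2.inner_def]
    exact integral_congr_ae ((hA φ).mono fun x hx => by simp only [hx])

end Representation

/-! ### Rank-one tensor measures -/

/-- The matrix-valued measure `a θ ⊗ θ μ`. -/
noncomputable def rankOneTensor {Ω : Set (EuclideanSpace ℝ (Fin N))} (μ : Measure (closure Ω))
    (θ : closure Ω → EuclideanSpace ℝ (Fin N)) (a : ℝ) : TensorMeasure Ω where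
  measureOf' s := Matrix.of fun i j => μ.withDensityᵥ (fun x => a * (θ x i * θ x j)) s
  empty' := by ext i j; simp
  not_measurable' s hs := by
    ext i j
    simp [VectorMeasure.not_measurable _ hs]
  m_iUnion' f hf hd := by
    exact Pi.hasSum.2 fun i => Pi.hasSum.2 fun j => VectorMeasure.m_iUnion _ hf hd

theorem rankOneTensor_entry {Ω : Set (EuclideanSpace ℝ (Fin N))} (μ : Measure (closure Ω))
    (θ : closure Ω → EuclideanSpace ℝ (Fin N)) (a : ℝ) (i j : Fin N) :
    (rankOneTensor μ θ a).entry i j = μ.withDensityᵥ (fun x => a * (θ x i * θ x j)) := by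
  ext s _
  rfl

section RankOne

variable {Ω : Set (EuclideanSpace ℝ (Fin N))} {μ : Measure (closure Ω)}
  {θ : closure Ω → EuclideanSpace ℝ (Fin N)}

theorem memLp_coord (hθ : MemLp θ 2 μ) (i : Fin N) : MemLp (fun x => θ x i) 2 μ :=
  (EuclideanSpace.proj i : EuclideanSpace ℝ (Fin N) →L[ℝ] ℝ).comp_memLp' hθ

theorem integrable_coord_mul (hθ : MemLp θ 2 μ) (a : ℝ) (i j : Fin N) :
    Integrable (fun x => a * (θ x i * θ x j)) μ :=
  ((memLp_coord hθ i).integrable_mul (memLp_coord hθ j)).const_mul a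

theorem rankOneTensor_apply (hθ : MemLp θ 2 μ) (a : ℝ) {s : Set (closure Ω)}
    (hs : MeasurableSet s) (i j : Fin N) :
    rankOneTensor μ θ a s i j = ∫ x in s, a * (θ x i * θ x j) ∂μ :=
  withDensityᵥ_apply (integrable_coord_mul hθ a i j) hs

theorem rankOneTensor_mem (hθ : MemLp θ 2 μ) {a : ℝ} (ha : 0 ≤ a) {Λ₀ : ℝ}
    (hΛ : a * ∫ x, ‖θ x‖ ^ 2 ∂μ ≤ Λ₀) : rankOneTensor μ θ a ∈ admissibleTensors Ω Λ₀ := by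
  refine ⟨fun s hs => ?_, ?_⟩
  · refine .of_dotProduct_mulVec_nonneg ?_ fun y => ?_
    · ext i j
      rw [Matrix.conjTranspose_apply, star_trivial, rankOneTensor_apply hθ a hs,
        rankOneTensor_apply hθ a hs]
      simp_rw [mul_comm (θ _ i)]
    · have h1 : star y ⬝ᵥ (rankOneTensor μ θ a s).mulVec y =
          ∫ x in s, a * (∑ i, y i * θ x i) ^ 2 ∂μ := by
        simp only [dotProduct, Matrix.mulVec, Pi.star_apply, star_trivial,
          rankOneTensor_apply hθ a hs]
        have h2 : ∀ x, a * (∑ i, y i * θ x i) ^ 2 =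
            ∑ i, ∑ j, y i * ((a * (θ x i * θ x j)) * y j) := fun x => by
          rw [sq, Finset.sum_mul_sum, Finset.mul_sum]
          refine Finset.sum_congr rfl fun i _ => ?_
          rw [Finset.mul_sum]
          exact Finset.sum_congr rfl fun j _ => by ring
        simp_rw [h2]
        have hintg : ∀ i j, Integrable (fun x => y i * ((a * (θ x i * θ x j)) * y j))
            (μ.restrict s) := fun i j =>
          (((integrable_coord_mul hθ a i j).mul_const _).const_mul _).restrict
        rw [integral_finsetSum _ fun i _ => integrable_finsetSum _ fun j _ => hintg i j]
        refine Finset.sum_congr rfl fun i _ => ?_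
        rw [integral_finsetSum _ fun j _ => hintg i j, Finset.mul_sum]
        refine Finset.sum_congr rfl fun j _ => ?_
        rw [integral_const_mul (y i), integral_mul_const (y j)]
      rw [h1]
      exact integral_nonneg fun x => mul_nonneg ha (sq_nonneg _)
  · refine le_trans (le_of_eq ?_) hΛ
    simp only [Matrix.trace, Matrix.diag, rankOneTensor_apply hθ a MeasurableSet.univ,
      Measure.restrict_univ]
    rw [← integral_finsetSum _ fun i _ => integrable_coord_mul hθ a i i, ← integral_const_mul]
    refine integral_congr_ae (Eventually.of_forall fun x => ?_)
    simp only [EuclideanSpace.real_norm_sq_eq, Finset.mul_sum]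
    exact Finset.sum_congr rfl fun i _ => by ring

theorem tensorEnergy_rankOneTensor [IsFiniteMeasure μ] (hΩ : Bornology.IsBounded Ω)
    (hθ : MemLp θ 2 μ) (a : ℝ)
    (φ : 𝓓((⊤ : TopologicalSpace.Opens (EuclideanSpace ℝ (Fin N))), ℝ)) :
    tensorEnergy (rankOneTensor μ θ a) φ =
      a * ∫ x, (inner ℝ (θ x) (∇ φ (x : EuclideanSpace ℝ (Fin N)))) ^ 2 ∂μ := by
  have : CompactSpace (closure Ω) := isCompact_iff_compactSpace.1 hΩ.isCompact_closure
  have hcont : ∀ i j, Continuous fun x : closure Ω =>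
      (∇ φ (x : EuclideanSpace ℝ (Fin N))) i * (∇ φ (x : EuclideanSpace ℝ (Fin N))) j := by
    have := continuous_gradient φ
    intro i j
    fun_prop
  have hbd : ∀ i j, ∃ c, 0 ≤ c ∧ ∀ x : closure Ω,
      ‖(∇ φ (x : EuclideanSpace ℝ (Fin N))) i * (∇ φ (x : EuclideanSpace ℝ (Fin N))) j‖ ≤ c :=
    fun i j => ⟨_, norm_nonneg _, (⟨_, hcont i j⟩ : C(closure Ω, ℝ)).norm_coe_le_norm⟩
  choose c hc0 hc using hbd
  have hintg : ∀ i j, Integrable (fun x : closure Ω => (∇ φ (x : EuclideanSpace ℝ (Fin N))) i *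
      (∇ φ (x : EuclideanSpace ℝ (Fin N))) j * (a * (θ x i * θ x j))) μ := fun i j =>
    (integrable_coord_mul hθ a i j).bdd_mul (c := c i j)
      (hcont i j).stronglyMeasurable.aestronglyMeasurable (Eventually.of_forall (hc i j))
  unfold tensorEnergy
  simp_rw [rankOneTensor_entry]
  have h1 : ∀ i j, pairing (μ.withDensityᵥ fun x => a * (θ x i * θ x j))
      (fun x => (∇ φ (x : EuclideanSpace ℝ (Fin N))) i * (∇ φ (x : EuclideanSpace ℝ (Fin N))) j) =
      ∫ x, (∇ φ (x : EuclideanSpace ℝ (Fin N))) i * (∇ φ (x : EuclideanSpace ℝ (Fin N))) j *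
        (a * (θ x i * θ x j)) ∂μ := fun i j =>
    pairing_withDensity (integrable_coord_mul hθ a i j) (hcont i j).stronglyMeasurable
      (hc0 i j) (hc i j)
  simp_rw [h1]
  rw [← integral_const_mul]
  simp_rw [← integral_finsetSum _ fun j _ => hintg _ j]
  rw [← integral_finsetSum _ fun i _ => integrable_finsetSum _ fun j _ => hintg i j]
  refine integral_congr_ae (Eventually.of_forall fun x => ?_)
  simp only [PiLp.inner_apply, RCLike.inner_apply, conj_trivial]
  rw [sq, Finset.sum_mul_sum, Finset.mul_sum]
  refine Finset.sum_congr rfl fun i _ => ?_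
  rw [Finset.mul_sum]
  exact Finset.sum_congr rfl fun j _ => by ring

end RankOne

/-! ### Upper bound for the optimal compliance -/

/-- Restriction of test functions, as a linear map. -/
noncomputable def restrictTestₗ (Ω : Set (EuclideanSpace ℝ (Fin N))) :
    𝓓((⊤ : TopologicalSpace.Opens (EuclideanSpace ℝ (Fin N))), ℝ) →ₗ[ℝ] LipFun Ω where
  toFun := restrictTest Ω
  map_add' _ _ := rfl
  map_smul' _ _ := rfl

theorem gradient_add_test (φ ψ : 𝓓((⊤ : TopologicalSpace.Opens (EuclideanSpace ℝ (Fin N))), ℝ))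
    (x : EuclideanSpace ℝ (Fin N)) : ∇ (φ + ψ) x = ∇ φ x + ∇ ψ x := by
  have h : ⇑(φ + ψ) = ⇑φ + ⇑ψ := rfl
  simp only [gradient]
  rw [h, fderiv_add (φ.contDiff.differentiable (by simp) x) (ψ.contDiff.differentiable (by simp) x),
    map_add]

theorem gradient_smul_test (c : ℝ)
    (φ : 𝓓((⊤ : TopologicalSpace.Opens (EuclideanSpace ℝ (Fin N))), ℝ))
    (x : EuclideanSpace ℝ (Fin N)) : ∇ (c • φ) x = c • ∇ φ x := by
  have h : ⇑(c • φ) = c • ⇑φ := rfl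
  simp only [gradient]
  rw [h, fderiv_const_smul (φ.contDiff.differentiable (by simp) x)]
  simp

/-- The gradient of a test function, as a continuous function on the closure of the domain. -/
noncomputable def gradientOn (Ω : Set (EuclideanSpace ℝ (Fin N))) :
    𝓓((⊤ : TopologicalSpace.Opens (EuclideanSpace ℝ (Fin N))), ℝ) →ₗ[ℝ]
      C(closure Ω, EuclideanSpace ℝ (Fin N)) where
  toFun φ := ⟨fun x => ∇ φ (x : EuclideanSpace ℝ (Fin N)),
    (continuous_gradient φ).comp continuous_subtype_val⟩
  map_add' φ ψ := by ext1 x; exact gradient_add_test φ ψ x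
  map_smul' c φ := by ext1 x; exact gradient_smul_test c φ x

theorem tensorEnergy_smul {Ω : Set (EuclideanSpace ℝ (Fin N))} (C : TensorMeasure Ω) (t : ℝ)
    (φ : 𝓓((⊤ : TopologicalSpace.Opens (EuclideanSpace ℝ (Fin N))), ℝ)) :
    tensorEnergy C (t • φ) = t ^ 2 * tensorEnergy C φ := by
  unfold tensorEnergy
  simp_rw [gradient_smul_test, Finset.mul_sum]
  refine Finset.sum_congr rfl fun i _ => Finset.sum_congr rfl fun j _ => ?_
  rw [pairing, pairing, ← smul_eq_mul (t ^ 2), ← VectorMeasure.integral_fun_smul]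
  congr 1
  ext x
  simp only [PiLp.smul_apply, smul_eq_mul]
  ring

theorem neg_two_mul_energy {Ω : Set (EuclideanSpace ℝ (Fin N))} (Q : LipFun Ω →ₗ[ℝ] ℝ)
    (C : TensorMeasure Ω) (φ : 𝓓((⊤ : TopologicalSpace.Opens (EuclideanSpace ℝ (Fin N))), ℝ)) :
    -2 * energy Q C φ = 2 * Q (restrictTest Ω φ) - tensorEnergy C φ := by
  unfold energy; ring

/-- A functional bounded by `I` times the sup norm of the gradient has optimal compliance at most
`I² / Λ₀`. -/
theorem optimalCompliance_le {Ω : Set (EuclideanSpace ℝ (Fin N))} (hbdd : Bornology.IsBounded Ω)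
    (hne : Ω.Nonempty) (Q : LipFun Ω →ₗ[ℝ] ℝ) {Λ₀ : ℝ} (hΛ : 0 < Λ₀) {I : ℝ} (hI : 0 ≤ I)
    [CompactSpace (closure Ω)]
    (hq : ∀ φ, Q (restrictTest Ω φ) ≤ I * ‖gradientOn Ω φ‖) :
    optimalCompliance Q Λ₀ ≤ ((I ^ 2 / Λ₀ : ℝ) : EReal) := by
  have : Nonempty (closure Ω) := hne.closure.to_subtype
  obtain ⟨μ, θ, hμ, hμI, hθ, hθI, hrep⟩ :=
    exists_density (gradientOn Ω) (Q.comp (restrictTestₗ Ω)) hI hq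
  rcases hI.eq_or_lt with rfl | hI0
  -- The weight `Λ₀ / I` degenerates here, but `Q` is nonpositive on test functions and the zero
  -- tensor suffices.
  · refine (iInf₂_le 0 ⟨fun s _ => Matrix.PosSemidef.zero, by simpa using hΛ.le⟩).trans ?_
    refine iSup_le fun φ => EReal.coe_le_coe_iff.2 ?_
    have h0 : tensorEnergy (0 : TensorMeasure Ω) φ = 0 := by
      have : ∀ i j, TensorMeasure.entry (0 : TensorMeasure Ω) i j = 0 := fun i j => by
        ext s _; rfl
      simp [tensorEnergy, this, pairing]
    rw [neg_two_mul_energy, h0]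
    have := hq φ
    rw [zero_mul] at this
    simp only [ne_eq, OfNat.ofNat_ne_zero, not_false_eq_true, zero_pow, zero_div]
    linarith
  -- Since `∫ |θ|² dμ ≤ I`, the weight `Λ₀ / I` respects the trace budget.
  · have hadm : rankOneTensor μ θ (Λ₀ / I) ∈ admissibleTensors Ω Λ₀ := by
      refine rankOneTensor_mem hθ (by positivity) ?_
      calc Λ₀ / I * ∫ x, ‖θ x‖ ^ 2 ∂μ ≤ Λ₀ / I * I := by gcongr
        _ = Λ₀ := by field_simp
    refine (iInf₂_le _ hadm).trans (iSup_le fun φ => EReal.coe_le_coe_iff.2 ?_)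
    rw [neg_two_mul_energy, tensorEnergy_rankOneTensor hbdd hθ]
    set S := ∫ x, (inner ℝ (θ x) (∇ φ (x : EuclideanSpace ℝ (Fin N)))) ^ 2 ∂μ with hS
    have hS0 : 0 ≤ S := integral_nonneg fun x => sq_nonneg _
    have hz : Q (restrictTest Ω φ) ^ 2 ≤ I * S := by
      have h1 : Q (restrictTest Ω φ) = ∫ x, inner ℝ (θ x) (gradientOn Ω φ x) ∂μ := hrep φ
      have h2 : MemLp (fun x => (inner ℝ (θ x) (gradientOn Ω φ x) : ℝ)) 2 μ := by
        refine hθ.of_le_mul (c := ‖gradientOn Ω φ‖)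
          (hθ.1.inner (gradientOn Ω φ).continuous.stronglyMeasurable.aestronglyMeasurable)
          (Eventually.of_forall fun x => ?_)
        rw [mul_comm]
        refine (norm_inner_le_norm _ _).trans ?_
        gcongr
        exact (gradientOn Ω φ).norm_coe_le_norm x
      rw [h1]
      refine (sq_integral_le h2).trans ?_
      exact mul_le_mul_of_nonneg_right hμI hS0
    set z := Q (restrictTest Ω φ)
    have h3 : Λ₀ * z ^ 2 / I ^ 2 ≤ Λ₀ / I * S := by
      rw [div_le_iff₀ (by positivity)]
      calc Λ₀ * z ^ 2 ≤ Λ₀ * (I * S) := by gcongr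
        _ = _ := by field_simp
    -- Completing the square; equality holds at `z = I² / Λ₀`.
    have h4 : 2 * z - Λ₀ * z ^ 2 / I ^ 2 ≤ I ^ 2 / Λ₀ := by
      have : I ^ 2 / Λ₀ - (2 * z - Λ₀ * z ^ 2 / I ^ 2) = (Λ₀ * z - I ^ 2) ^ 2 / (Λ₀ * I ^ 2) := by
        field_simp; ring
      have h5 : 0 ≤ (Λ₀ * z - I ^ 2) ^ 2 / (Λ₀ * I ^ 2) := by positivity
      linarith
    linarith

/-! ### Compactness and density properties of `Lip₁` -/

section LipOne

variable {Ω : Set (EuclideanSpace ℝ (Fin N))}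

theorem zero_mem_lipOne : (0 : LipFun Ω) ∈ LipOne Ω := fun x y => by simp

theorem neg_mem_lipOne {u : LipFun Ω} (hu : u ∈ LipOne Ω) : -u ∈ LipOne Ω := fun x y => by
  change edist (-(u.1 x)) (-(u.1 y)) ≤ _
  rw [edist_neg_neg]
  exact hu x y

/-- The constant functions, as elements of `Lip(Ω̄)`. -/
def constLip (Ω : Set (EuclideanSpace ℝ (Fin N))) (c : ℝ) : LipFun Ω := ⟨fun _ => c, 0, by simp⟩

theorem constLip_mem_lipOne (c : ℝ) : constLip Ω c ∈ LipOne Ω := fun x y => by simp [constLip]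

theorem sub_constLip_mem_lipOne {u : LipFun Ω} (hu : u ∈ LipOne Ω) (c : ℝ) :
    u - constLip Ω c ∈ LipOne Ω := fun x y => by
  change edist (u.1 x - c) (u.1 y - c) ≤ _
  rw [edist_sub_right]
  exact hu x y

theorem extend_apply (u : closure Ω → ℝ) (x : closure Ω) :
    Function.extend Subtype.val u 0 (x : EuclideanSpace ℝ (Fin N)) = u x :=
  Subtype.val_injective.extend_apply u 0 x

theorem exists_forall_lipOne_dist_lt (hΩ : IsOpen Ω)
    (hbdd : Bornology.IsBounded Ω) (hlip : HasLipschitzBoundary Ω) {ε : ℝ} (hε : 0 < ε) :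
    ∃ δ > 0, ∀ u ∈ LipOne Ω, ∀ x y : closure Ω, dist x y < δ → dist (u.1 x) (u.1 y) < ε := by
  obtain ⟨δ, hδ, h⟩ := exists_forall_dist_lt hΩ hbdd hlip hε
  refine ⟨δ, hδ, fun u hu x y hxy => ?_⟩
  simpa only [extend_apply] using h _ (isSegmentLip_of_mem_lipOne hu) x x.2 y y.2 hxy

theorem continuous_of_mem_lipOne (hΩ : IsOpen Ω)
    (hbdd : Bornology.IsBounded Ω) (hlip : HasLipschitzBoundary Ω) {u : LipFun Ω}
    (hu : u ∈ LipOne Ω) : Continuous u.1 := by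
  refine (Metric.uniformContinuous_iff.2 fun ε hε => ?_).continuous
  obtain ⟨δ, hδ, h⟩ := exists_forall_lipOne_dist_lt hΩ hbdd hlip hε
  exact ⟨δ, hδ, fun {x y} hxy => h u hu x y hxy⟩

theorem exists_forall_lipOne_dist_le (hΩ : IsOpen Ω) (hbdd : Bornology.IsBounded Ω)
    (hconn : IsConnected Ω) (hlip : HasLipschitzBoundary Ω) :
    ∃ D : ℝ, ∀ u ∈ LipOne Ω, ∀ x y : closure Ω, dist (u.1 x) (u.1 y) ≤ D := by
  obtain ⟨D, h⟩ := exists_forall_dist_le hΩ hbdd hconn hlip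
  refine ⟨D, fun u hu x y => ?_⟩
  simpa only [extend_apply] using h _ (isSegmentLip_of_mem_lipOne hu) x x.2 y y.2

theorem restrictTest_mem_lipOne {φ : 𝓓((⊤ : TopologicalSpace.Opens (EuclideanSpace ℝ (Fin N))), ℝ)}
    (hφ : ∀ x ∈ closure Ω, ‖fderiv ℝ φ x‖ ≤ 1) : restrictTest Ω φ ∈ LipOne Ω := fun x y => by
  have h := edist_le_mul_geodesicEDist_of_norm_fderiv_le (K := closure Ω) (f := φ) (M := 1)
    (φ.contDiff.of_le (by simp)) one_ne_zero hφ x y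
  rwa [ENNReal.coe_one, one_mul] at h

theorem fderiv_smul_test (c : ℝ)
    (φ : 𝓓((⊤ : TopologicalSpace.Opens (EuclideanSpace ℝ (Fin N))), ℝ))
    (x : EuclideanSpace ℝ (Fin N)) : fderiv ℝ (c • φ) x = c • fderiv ℝ φ x :=
  fderiv_const_smul (φ.contDiff.differentiable (by simp) x) c

/-- Test functions in `Lip₁(Ω̄)` are uniformly dense in `Lip₁(Ω̄)`. -/
theorem exists_test_lipOne_approx (hΩ : IsOpen Ω) (hbdd : Bornology.IsBounded Ω)
    (hlip : HasLipschitzBoundary Ω) {u : LipFun Ω} (hu : u ∈ LipOne Ω) {η : ℝ} (hη : 0 < η) :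
    ∃ φ, restrictTest Ω φ ∈ LipOne Ω ∧ ∀ x, |(restrictTest Ω φ).1 x - u.1 x| ≤ η := by
  have : CompactSpace (closure Ω) := isCompact_iff_compactSpace.1 hbdd.isCompact_closure
  let f : C(closure Ω, ℝ) := ⟨u.1, continuous_of_mem_lipOne hΩ hbdd hlip hu⟩
  have hf : ∀ x, |u.1 x| ≤ ‖f‖ := f.norm_coe_le_norm
  -- The approximation costs `2 * ε`; dividing by `1 + ε` to restore the gradient bound costs at
  -- most `ε * ‖f‖`.
  obtain ⟨ε, hε, hεη⟩ : ∃ ε : ℝ≥0, 0 < ε ∧ (ε : ℝ) * (2 + ‖f‖) ≤ η :=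
    ⟨(η / (2 + ‖f‖)).toNNReal, by rw [Real.toNNReal_pos]; positivity, by
      rw [Real.coe_toNNReal _ (by positivity)]; field_simp; rfl⟩
  obtain ⟨φ, hφ⟩ := exists_test_approx hΩ hbdd hlip (isSegmentLip_of_mem_lipOne hu) (B := ‖f‖)
    (fun x hx => by simpa only [extend_apply u.1 ⟨x, hx⟩] using hf ⟨x, hx⟩) hε
  have hε1 : (0 : ℝ) < 1 + ε := by positivity
  refine ⟨(1 + (ε : ℝ))⁻¹ • φ, restrictTest_mem_lipOne fun x hx => ?_, fun x => ?_⟩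
  · rw [fderiv_smul_test, norm_smul, Real.norm_of_nonneg (by positivity),
      inv_mul_le_one₀ hε1]
    exact (hφ x hx).1
  · change |(1 + (ε : ℝ))⁻¹ * φ x - u.1 x| ≤ η
    have h1 : |φ x - u.1 x| ≤ 2 * ε := by
      have := (hφ x x.2).2
      rwa [extend_apply, Real.dist_eq] at this
    have h2 : (1 + (ε : ℝ))⁻¹ * φ x - u.1 x =
        (1 + (ε : ℝ))⁻¹ * ((φ x - u.1 x) - ε * u.1 x) := by
      field_simp; ring
    rw [h2, abs_mul, abs_of_nonneg (by positivity : (0 : ℝ) ≤ (1 + (ε : ℝ))⁻¹)]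
    calc (1 + (ε : ℝ))⁻¹ * |φ x - u.1 x - ε * u.1 x|
        ≤ 1 * (|φ x - u.1 x| + |ε * u.1 x|) := by
          gcongr
          · exact inv_le_one_of_one_le₀ (by simp)
          · exact abs_sub _ _
      _ ≤ 2 * ε + ε * ‖f‖ := by
          rw [one_mul, abs_mul, abs_of_nonneg ε.coe_nonneg]
          gcongr
          exact hf x
      _ = ε * (2 + ‖f‖) := by ring
      _ ≤ η := hεη

end LipOne

/-! ### Continuity of the functionals and existence of a maximizer -/

section Functional

variable {Ω : Set (EuclideanSpace ℝ (Fin N))} {Q : LipFun Ω →ₗ[ℝ] ℝ}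

/-- The one-sided Kantorovich bound becomes two-sided because `Lip₁` is symmetric under negation. -/
theorem exists_measure_approx (hQ : Q ∈ MZeroOne Ω) {ε : ℝ} (hε : 0 < ε) :
    ∃ ν : SignedMeasure (closure Ω), ν univ = 0 ∧ ∀ u ∈ LipOne Ω, |Q u - pairing ν u.1| ≤ ε := by
  obtain ⟨ν, hν, h⟩ := hQ ε hε
  have hle : ∀ u ∈ LipOne Ω, Q u - pairing ν u.1 ≤ ε := fun u hu =>
    EReal.coe_le_coe_iff.1 ((le_iSup₂ (f := fun (u : LipFun Ω) (_ : u ∈ LipOne Ω) =>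
      ((Q u - pairing ν u.1 : ℝ) : EReal)) u hu).trans h)
  refine ⟨ν, hν, fun u hu => abs_le.2 ⟨?_, hle u hu⟩⟩
  have h1 := hle (-u) (neg_mem_lipOne hu)
  have h2 : pairing ν (-u).1 = -pairing ν u.1 := VectorMeasure.integral_neg _ _ _
  rw [map_neg, h2] at h1
  linarith

theorem map_constLip (hQ : Q ∈ MZeroOne Ω) (c : ℝ) : Q (constLip Ω c) = 0 := by
  refine abs_nonpos_iff.1 (le_of_forall_pos_le_add fun ε hε => ?_)
  obtain ⟨ν, hν, h⟩ := exists_measure_approx hQ hε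
  have h1 := h _ (constLip_mem_lipOne c)
  have h2 : pairing ν (constLip Ω c).1 = 0 := by
    rw [show (constLip Ω c).1 = fun _ => c from rfl, pairing_const, hν, mul_zero]
  rw [h2, sub_zero] at h1
  linarith

/-- On `Lip₁(Ω̄)` the functionals in `M_{0,1}(Ω̄)` are uniformly continuous for uniform
convergence. -/
theorem exists_forall_abs_sub_le (hΩ : IsOpen Ω) (hbdd : Bornology.IsBounded Ω)
    (hlip : HasLipschitzBoundary Ω) (hQ : Q ∈ MZeroOne Ω) {ε : ℝ} (hε : 0 < ε) :
    ∃ δ > 0, ∀ u ∈ LipOne Ω, ∀ w ∈ LipOne Ω, (∀ x, |u.1 x - w.1 x| ≤ δ) → |Q u - Q w| ≤ ε := by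
  have : CompactSpace (closure Ω) := isCompact_iff_compactSpace.1 hbdd.isCompact_closure
  obtain ⟨ν, -, h⟩ := exists_measure_approx hQ (ε := ε / 4) (by positivity)
  have hM : 0 ≤ ν.variation.real univ := measureReal_nonneg
  set M := ν.variation.real univ
  -- Replacing `Q` by `ν` costs `ε / 4` at each of `u` and `w`, which leaves `ε / 2` for the
  -- integral of `u - w`.
  refine ⟨ε / (2 * (M + 1)), by positivity, fun u hu w hw huw => ?_⟩
  have hintg : ∀ u ∈ LipOne Ω, Integrable u.1 ν.variation := fun u hu => by
    let f : C(closure Ω, ℝ) := ⟨u.1, continuous_of_mem_lipOne hΩ hbdd hlip hu⟩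
    exact Integrable.of_bound f.continuous.stronglyMeasurable.aestronglyMeasurable ‖f‖
      (Eventually.of_forall f.norm_coe_le_norm)
  have h1 := abs_pairing_le ν huw
  rw [pairing_sub ν (hintg u hu) (hintg w hw)] at h1
  have h2 : ε / (2 * (M + 1)) * M ≤ ε / 2 := by
    calc ε / (2 * (M + 1)) * M ≤ ε / (2 * (M + 1)) * (M + 1) := by gcongr; linarith
      _ = ε / 2 := by field_simp
  have h3 := abs_le.1 (h u hu)
  have h4 := abs_le.1 (h w hw)
  have h5 := abs_le.1 (h1.trans h2)
  exact abs_le.2 ⟨by linarith [h3.1, h4.2, h5.1], by linarith [h3.2, h4.1, h5.2]⟩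

/-- A functional in `M_{0,1}(Ω̄)` attains its maximum on `Lip₁(Ω̄)`. -/
theorem exists_maximizer (hΩ : IsOpen Ω) (hbdd : Bornology.IsBounded Ω) (hconn : IsConnected Ω)
    (hlip : HasLipschitzBoundary Ω) (hQ : Q ∈ MZeroOne Ω) :
    ∃ û ∈ LipOne Ω, ∀ u ∈ LipOne Ω, Q u ≤ Q û := by
  classical
  have : CompactSpace (closure Ω) := isCompact_iff_compactSpace.1 hbdd.isCompact_closure
  obtain ⟨x₀⟩ : Nonempty (closure Ω) := hconn.nonempty.closure.to_subtype
  obtain ⟨D, hD⟩ := exists_forall_lipOne_dist_le hΩ hbdd hconn hlip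
  -- Normalising at `x₀` turns bounded oscillation into a uniform bound; nothing is lost, since `Q`
  -- vanishes on constants.
  let A : Set (BoundedContinuousFunction (closure Ω) ℝ) :=
    {f | (∀ x y, edist (f x) (f y) ≤ geodesicEDist (closure Ω) x y) ∧ f x₀ = 0}
  have hmem : ∀ f ∈ A, (f : closure Ω → ℝ) ∈ LipFun Ω := fun f hf =>
    ⟨1, fun x y => by simpa using hf.1 x y⟩
  have hone : ∀ f (hf : f ∈ A), (⟨f, hmem f hf⟩ : LipFun Ω) ∈ LipOne Ω := fun f hf => hf.1
  have hclosed : IsClosed A := by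
    have hA : A = (⋂ x : closure Ω, ⋂ y : closure Ω,
        {f | edist (f x) (f y) ≤ geodesicEDist (closure Ω) x y}) ∩ {f | f x₀ = 0} := by
      ext f; simp [A]
    rw [hA]
    refine (isClosed_iInter fun x => isClosed_iInter fun y => ?_).inter ?_
    · exact isClosed_le ((continuous_eval_const x).edist (continuous_eval_const y))
        continuous_const
    · exact isClosed_eq (continuous_eval_const x₀) continuous_const
  have hcompact : IsCompact A := by
    refine BoundedContinuousFunction.arzela_ascoli₂ (Metric.closedBall 0 D)
      (isCompact_closedBall 0 D) A hclosed (fun f x hf => ?_) ?_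
    · have := hD _ (hone f hf) x x₀
      simp only [hf.2] at this
      exact this
    · refine (Metric.uniformEquicontinuous_iff.2 fun ε hε => ?_).equicontinuous
      obtain ⟨δ, hδ, h⟩ := exists_forall_lipOne_dist_lt hΩ hbdd hlip hε
      exact ⟨δ, hδ, fun x y hxy f => h _ (hone f.1 f.2) x y hxy⟩
  let q : BoundedContinuousFunction (closure Ω) ℝ → ℝ := fun f =>
    if h : (f : closure Ω → ℝ) ∈ LipFun Ω then Q ⟨f, h⟩ else 0
  have hq : ∀ f (hf : f ∈ A), q f = Q ⟨f, hmem f hf⟩ := fun f hf => dif_pos (hmem f hf)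
  have hqcont : ContinuousOn q A := by
    refine Metric.continuousOn_iff.2 fun g hg ε hε => ?_
    obtain ⟨δ, hδ, h⟩ := exists_forall_abs_sub_le hΩ hbdd hlip hQ (half_pos hε)
    refine ⟨δ, hδ, fun f hf hfg => ?_⟩
    rw [hq f hf, hq g hg, Real.dist_eq]
    refine (h _ (hone f hf) _ (hone g hg) fun x => ?_).trans_lt (half_lt_self hε)
    exact (BoundedContinuousFunction.dist_coe_le_dist x).trans hfg.le
  have h0 : (0 : BoundedContinuousFunction (closure Ω) ℝ) ∈ A := ⟨fun x y => by simp, rfl⟩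
  obtain ⟨f, hf, hmax⟩ := hcompact.exists_isMaxOn ⟨0, h0⟩ hqcont
  refine ⟨⟨f, hmem f hf⟩, hone f hf, fun u hu => ?_⟩
  have hu' := sub_constLip_mem_lipOne hu (u.1 x₀)
  let g : BoundedContinuousFunction (closure Ω) ℝ := BoundedContinuousFunction.mkOfCompact
    ⟨_, continuous_of_mem_lipOne hΩ hbdd hlip hu'⟩
  have hg : g ∈ A := ⟨hu', sub_self (u.1 x₀)⟩
  have h1 : q g ≤ q f := hmax hg
  rw [hq f hf, hq g hg] at h1
  have h2 : Q (u - constLip Ω (u.1 x₀)) ≤ Q ⟨f, hmem f hf⟩ := h1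
  rwa [map_sub, map_constLip hQ, sub_zero] at h2

end Functional

/-! ### The two bounds and the conclusion -/

section Main

variable {Ω : Set (EuclideanSpace ℝ (Fin N))} {Q : LipFun Ω →ₗ[ℝ] ℝ}

/-- For `M` above the sup norm of the gradient, `M⁻¹ • φ` lies in `Lip₁`. Taking `M` strictly larger
also covers a vanishing gradient. -/
theorem le_mul_norm_gradientOn [CompactSpace (closure Ω)] {R : ℝ} (hR : 0 ≤ R)
    (hQR : ∀ u ∈ LipOne Ω, Q u ≤ R)
    (φ : 𝓓((⊤ : TopologicalSpace.Opens (EuclideanSpace ℝ (Fin N))), ℝ)) :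
    Q (restrictTest Ω φ) ≤ R * ‖gradientOn Ω φ‖ := by
  have key : ∀ M : ℝ, ‖gradientOn Ω φ‖ < M → Q (restrictTest Ω φ) ≤ R * M := by
    intro M hM
    have hM0 : 0 < M := (norm_nonneg _).trans_lt hM
    have h1 : restrictTest Ω (M⁻¹ • φ) ∈ LipOne Ω := by
      refine restrictTest_mem_lipOne fun x hx => ?_
      rw [fderiv_smul_test, norm_smul, Real.norm_of_nonneg (by positivity), inv_mul_le_one₀ hM0,
        ← norm_gradient_eq]
      exact ((gradientOn Ω φ).norm_coe_le_norm ⟨x, hx⟩).trans hM.le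
    have h2 : Q (restrictTest Ω (M⁻¹ • φ)) = M⁻¹ * Q (restrictTest Ω φ) :=
      Q.map_smul M⁻¹ (restrictTest Ω φ)
    have h3 := hQR _ h1
    rwa [h2, inv_mul_le_iff₀ hM0, mul_comm] at h3
  refine le_of_forall_pos_le_add fun ε hε => ?_
  refine (key (‖gradientOn Ω φ‖ + ε / (R + 1)) (by simp; positivity)).trans ?_
  have : R * (ε / (R + 1)) ≤ ε := by
    rw [mul_div_assoc', div_le_iff₀ (by positivity)]
    nlinarith
  linarith

theorem le_compliance_of_test (hΩ : IsOpen Ω) {Λ₀ : ℝ} {C : TensorMeasure Ω}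
    (hC : C ∈ admissibleTensors Ω Λ₀)
    {φ : 𝓓((⊤ : TopologicalSpace.Opens (EuclideanSpace ℝ (Fin N))), ℝ)}
    (hφ : restrictTest Ω φ ∈ LipOne Ω) (t : ℝ) :
    ((2 * t * Q (restrictTest Ω φ) - t ^ 2 * Λ₀ : ℝ) : EReal) ≤ compliance Q C := by
  refine le_trans (EReal.coe_le_coe_iff.2 ?_)
    (le_iSup (fun φ => ((-2 * energy Q C φ : ℝ) : EReal)) (t • φ))
  have h1 : Q (restrictTest Ω (t • φ)) = t * Q (restrictTest Ω φ) :=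
    Q.map_smul t (restrictTest Ω φ)
  rw [neg_two_mul_energy, tensorEnergy_smul, h1]
  have := mul_le_mul_of_nonneg_left
    (tensorEnergy_le hC fun x hx => norm_gradient_le_one hΩ hφ hx) (sq_nonneg t)
  linarith

theorem exists_test_lt (hΩ : IsOpen Ω) (hbdd : Bornology.IsBounded Ω)
    (hlip : HasLipschitzBoundary Ω) (hQ : Q ∈ MZeroOne Ω) {u : LipFun Ω} (hu : u ∈ LipOne Ω)
    {c : ℝ} (hc : c < Q u) :
    ∃ φ, restrictTest Ω φ ∈ LipOne Ω ∧ c < Q (restrictTest Ω φ) := by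
  obtain ⟨δ, hδ, h⟩ := exists_forall_abs_sub_le hΩ hbdd hlip hQ (half_pos (sub_pos.2 hc))
  obtain ⟨φ, hφ, hφu⟩ := exists_test_lipOne_approx hΩ hbdd hlip hu hδ
  have := (abs_le.1 (h _ hφ u hu hφu)).1
  exact ⟨φ, hφ, by linarith⟩

theorem le_optimalCompliance (hΩ : IsOpen Ω) (hbdd : Bornology.IsBounded Ω)
    (hlip : HasLipschitzBoundary Ω) (hQ : Q ∈ MZeroOne Ω) {Λ₀ : ℝ} (hΛ : 0 < Λ₀)
    {u : LipFun Ω} (hu : u ∈ LipOne Ω) :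
    ((Q u ^ 2 / Λ₀ : ℝ) : EReal) ≤ optimalCompliance Q Λ₀ := by
  refine le_iInf₂ fun C hC => EReal.ge_of_forall_gt_iff_ge.1 fun c hc => ?_
  set R := Q u
  have hc' : c < R ^ 2 / Λ₀ := EReal.coe_lt_coe_iff.1 hc
  -- Replacing `R` by `z = ⟨Q, φ⟩` changes the bound by `2R(z - R) / Λ₀`, which must not exceed the
  -- gap `R² / Λ₀ - c`. Using `|R| + 1` avoids dividing by zero.
  obtain ⟨δ, hδ, h⟩ := exists_forall_abs_sub_le hΩ hbdd hlip hQ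
    (ε := (R ^ 2 / Λ₀ - c) * Λ₀ / (2 * (|R| + 1)))
    (by have := sub_pos.2 hc'; positivity)
  obtain ⟨φ, hφ, hφu⟩ := exists_test_lipOne_approx hΩ hbdd hlip hu hδ
  -- `t = R / Λ₀` maximises `2tR - t²Λ₀`.
  refine le_trans (EReal.coe_le_coe_iff.2 ?_) (le_compliance_of_test hΩ hC hφ (R / Λ₀))
  have h1 := h _ hφ u hu hφu
  set z := Q (restrictTest Ω φ)
  have h2 : |R| * |z - R| ≤ (R ^ 2 / Λ₀ - c) * Λ₀ / 2 := by
    calc |R| * |z - R| ≤ (|R| + 1) * ((R ^ 2 / Λ₀ - c) * Λ₀ / (2 * (|R| + 1))) := by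
          gcongr
          linarith
      _ = _ := by field_simp
  rw [← abs_mul] at h2
  have h3 := (abs_le.1 h2).1
  have h4 : 2 * (R / Λ₀) * z - (R / Λ₀) ^ 2 * Λ₀ = R ^ 2 / Λ₀ + 2 * (R * (z - R)) / Λ₀ := by
    field_simp; ring
  have h5 : -(R ^ 2 / Λ₀ - c) ≤ 2 * (R * (z - R)) / Λ₀ := by
    rw [le_div_iff₀ hΛ]; linarith
  linarith

end Main

end ThermalCompliance

theorem proposition3p1 {N : ℕ} (Ω : Set (EuclideanSpace ℝ (Fin N))) (hΩ_open : IsOpen Ω)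
    (hΩ_bdd : Bornology.IsBounded Ω) (hΩ_conn : IsConnected Ω)
    (hΩ_lip : ThermalCompliance.HasLipschitzBoundary Ω)
    (Q : ThermalCompliance.LipFun Ω →ₗ[ℝ] ℝ) (hQ : Q ∈ ThermalCompliance.MZeroOne Ω)
    (Λ₀ : ℝ) (hΛ₀ : 0 < Λ₀) :
    (0 ≤ ThermalCompliance.optimalCompliance Q Λ₀ ∧ ThermalCompliance.optimalCompliance Q Λ₀ < ⊤) ∧
    ((√(ThermalCompliance.optimalCompliance Q Λ₀).toReal : ℝ) : EReal) =
      ((1 / √Λ₀ : ℝ) : EReal) *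
        ⨆ φ ∈ {φ | ThermalCompliance.restrictTest Ω φ ∈ ThermalCompliance.LipOne Ω},
          (Q (ThermalCompliance.restrictTest Ω φ) : EReal) ∧
    ((√(ThermalCompliance.optimalCompliance Q Λ₀).toReal : ℝ) : EReal) =
      ((1 / √Λ₀ : ℝ) : EReal) * ThermalCompliance.kantorovichNorm Q ∧
    ∃ û ∈ ThermalCompliance.LipOne Ω, (Q û : EReal) = ThermalCompliance.kantorovichNorm Q := by
  open ThermalCompliance in
  have : CompactSpace (closure Ω) := isCompact_iff_compactSpace.1 hΩ_bdd.isCompact_closure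
  obtain ⟨û, hû, hmax⟩ := exists_maximizer hΩ_open hΩ_bdd hΩ_conn hΩ_lip hQ
  have hR : 0 ≤ Q û := by simpa using hmax 0 zero_mem_lipOne
  have hY : optimalCompliance Q Λ₀ = ((Q û ^ 2 / Λ₀ : ℝ) : EReal) :=
    le_antisymm (optimalCompliance_le hΩ_bdd hΩ_conn.nonempty Q hΛ₀ hR
      (le_mul_norm_gradientOn hR hmax)) (le_optimalCompliance hΩ_open hΩ_bdd hΩ_lip hQ hΛ₀ hû)
  have hnorm : (Q û : EReal) = kantorovichNorm Q :=
    le_antisymm (le_iSup₂ (f := fun (u : LipFun Ω) (_ : u ∈ LipOne Ω) => (Q u : EReal)) û hû)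
      (iSup₂_le fun u hu => EReal.coe_le_coe_iff.2 (hmax u hu))
  have hsup : ⨆ φ ∈ {φ | restrictTest Ω φ ∈ LipOne Ω}, (Q (restrictTest Ω φ) : EReal) = Q û := by
    refine le_antisymm (iSup₂_le fun φ hφ => EReal.coe_le_coe_iff.2 (hmax _ hφ)) ?_
    refine EReal.ge_of_forall_gt_iff_ge.1 fun c hc => ?_
    obtain ⟨φ, hφ, hcφ⟩ := exists_test_lt hΩ_open hΩ_bdd hΩ_lip hQ hû (EReal.coe_lt_coe_iff.1 hc)
    exact (EReal.coe_le_coe_iff.2 hcφ.le).trans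
      (le_iSup₂ (f := fun φ (_ : φ ∈ {φ | restrictTest Ω φ ∈ LipOne Ω}) =>
        (Q (restrictTest Ω φ) : EReal)) φ hφ)
  have hsqrt : √(Q û ^ 2 / Λ₀) = 1 / √Λ₀ * Q û := by
    rw [Real.sqrt_div (sq_nonneg _), Real.sqrt_sq hR]; ring
  rw [hsup, ← hnorm, hY, EReal.toReal_coe, hsqrt, EReal.coe_mul]
  exact ⟨⟨EReal.coe_nonneg.2 (by positivity), EReal.coe_lt_top _⟩, rfl, rfl, û, hû, rfl⟩
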